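/- **Matching weight and rate.** For $d\ge 0$ let $\mathcal A_d$ be the collection of rooted trees (of height at most $d$) all of whose leaves have depth $d$. For rooted trees $\mathcal T,\mathcal T'$ and $d\ge 0$ let $\mathcal W_d(\mathcal T,\mathcal T')$ be the supremum of the number of leaves of $t$, over all $t\in\mathcal A_d$ that admit injective embeddings into $\mathcal T$ and into $\mathcal T'$ sending root to root and the parent of each non-root vertex to the parent of its image ($\mathcal W_d=0$ if there is no such $t$). The matching rate of a pair of random rooted trees is $$\gamma(\mathcal T,\mathcal T'):=\inf\Big\{\gamma\in\mathbb R:\ \exists\, m,c,d_0>0,\ \forall x\ge 0,\ \forall d\ge d_0,\ \mathbb P\big(\mathcal W_d(\mathcal T,\mathcal T')\ge m x\gamma^d\big)\le e^{-(x-c)_+}\Big\}\in[-\infty,+\infty],$$ with $\inf\varnothing=+\infty$. **Model $GW(\lambda,s,\delta)$** ($\lambda>0$, $s\in[0,1]$, $\delta\ge 1$ an integer). The tree $\mathcal T$ is rooted at $\rho$, the tree $\mathcal T'$ is rooted at $\rho'$, and $\rho'$ is also a vertex of $\mathcal T$, at distance $\delta$ from $\rho$. Each vertex of the path in $\mathcal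 T$ from $\rho$ to the parent of $\rho'$ has, besides its child leading to $\rho'$, $\mathrm{Poi}(\lambda)$ further children, which belong only to $\mathcal T$. The intersection of $\mathcal T$ and $\mathcal T'$ is a Galton–Watson tree rooted at $\rho'$ with offspring $\mathrm{Poi}(\lambda s)$. Each vertex of the intersection has, in addition, $\mathrm{Poi}(\lambda(1-s))$ children that are only in $\mathcal T$ and $\mathrm{Poi}(\lambda(1-s))$ children that are only in $\mathcal T'$. Each vertex that is only in $\mathcal T$ and not on the path (resp. only in $\mathcal T'$) has $\mathrm{Poi}(\lambda)$ children, which are only in $\mathcal T$ (resp. only in $\mathcal T'$). All these numbers are independent. Let $\gamma(\lambda,s,\delta):=\gamma(\mathcal T,\mathcal T')$ for $(\mathcal T,\mathcal T')\sim GW(\lambda,s,\delta)$. **Theorem.** There exists $\lambda_0>1$ such that for all $\lambda\in(1,\lambda_0]$ and all $s\in[0,1]$, $$\sup_{\delta\ge 1}\gamma(\lambda,s,\delta)<\lambda .$$ -/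

import Mathlib

open MeasureTheory ProbabilityTheory
open scoped NNReal ENNReal

noncomputable section

namespace TreeMatching

/-! ### Rooted trees -/

/-- The depth of a vertex: its distance from the root. In the Mathlib type `RootedTree`, the root
is `⊥` and the parent of `v` is `Order.pred v` (the root is sent to itself). -/
def depth (t : RootedTree.{0}) (v : t) : ℕ := sInf {n : ℕ | Order.pred^[n] v = ⊥}

/-- A leaf is a vertex without children. -/
def IsLeaf (t : RootedTree.{0}) (v : t) : Prop := ∀ w : t, w ≠ ⊥ → Order.pred w ≠ v

/-- The set of vertices at depth `d`. -/
def level (t : RootedTree.{0}) (d : ℕ) : Set t := {v | depth t v = d}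

/-- The rooted trees (of height at most `d`) all of whose leaves have depth `d`. -/
def AllLeavesAt (d : ℕ) (t : RootedTree.{0}) : Prop :=
  (∀ v : t, depth t v ≤ d) ∧ ∀ v : t, IsLeaf t v → depth t v = d

/-- `f` is an injective embedding of `t` into `T` that preserves the rooted tree structure. -/
structure IsEmbedding (t T : RootedTree.{0}) (f : t → T) : Prop where
  injective : Function.Injective f
  map_root : f ⊥ = ⊥
  map_parent : ∀ i : t, i ≠ ⊥ → f (Order.pred i) = Order.pred (f i)

/-- The data of a root and of a parent map on a set of vertices, such that every vertex reaches
the root by going to parents. -/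
structure ParentMap (V : Type) where
  root : V
  parent : V → V
  parent_root : parent root = root
  reaches : ∀ v, ∃ n : ℕ, parent^[n] v = root

namespace ParentMap

variable {V : Type} (P : ParentMap V)

theorem iterate_root (n : ℕ) : P.parent^[n] P.root = P.root :=
  Function.iterate_fixed P.parent_root n

theorem eq_root_of_iterate {n : ℕ} (hn : n ≠ 0) {v : V} (h : P.parent^[n] v = v) :
    v = P.root := by
  obtain ⟨k, hk⟩ := P.reaches v
  have h1 : P.parent^[n * k] v = v := by
    rw [Function.iterate_mul]
    exact Function.iterate_fixed h k
  obtain ⟨j, hj⟩ : ∃ j, n * k = j + k :=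
    Nat.exists_eq_add_of_le' (Nat.le_mul_of_pos_left k (Nat.pos_of_ne_zero hn))
  rw [← h1, hj, Function.iterate_add_apply, hk, P.iterate_root]

/-- The ancestorship order. -/
abbrev partialOrder : PartialOrder V where
  le v w := ∃ n : ℕ, P.parent^[n] w = v
  le_refl v := ⟨0, rfl⟩
  le_trans := by
    rintro a b c ⟨n, rfl⟩ ⟨m, rfl⟩
    exact ⟨n + m, Function.iterate_add_apply _ _ _ _⟩
  le_antisymm := by
    rintro a b ⟨n, rfl⟩ ⟨m, hm⟩
    rcases Nat.eq_zero_or_pos n with rfl | hn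
    · rfl
    · rw [← Function.iterate_add_apply] at hm
      rw [P.eq_root_of_iterate (by omega) hm, P.iterate_root]

open Classical in
/-- The last common ancestor. -/
abbrev semilatticeInf : SemilatticeInf V :=
  letI := P.partialOrder
  have hex : ∀ v w : V, ∃ n : ℕ, P.parent^[n] v ≤ w := fun v w => by
    obtain ⟨n, hn⟩ := P.reaches v
    obtain ⟨m, hm⟩ := P.reaches w
    exact ⟨n, m, hm.trans hn.symm⟩
  { P.partialOrder with
    inf := fun v w => P.parent^[Nat.find (hex v w)] v
    inf_le_left := fun v w => ⟨_, rfl⟩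
    inf_le_right := fun v w => Nat.find_spec (hex v w)
    le_inf := by
      rintro a v w ⟨n, rfl⟩ haw
      have h := Nat.find_min' (hex v w) haw
      obtain ⟨j, hj⟩ := Nat.exists_eq_add_of_le' h
      exact ⟨j, by rw [← Function.iterate_add_apply, ← hj]⟩ }

/-- The rooted tree with a given root and a given parent map. -/
def toRootedTree : RootedTree.{0} :=
  letI := P.semilatticeInf
  letI : OrderBot V := { bot := P.root, bot_le := P.reaches }
  letI : PredOrder V :=
    { pred := P.parent
      pred_le := fun v => ⟨1, rfl⟩
      min_of_le_pred := by
        rintro v ⟨n, hn⟩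
        rw [← Function.iterate_succ_apply] at hn
        rw [P.eq_root_of_iterate (Nat.succ_ne_zero n) hn]
        exact isMin_bot
      le_pred_of_lt := by
        rintro a b hab
        obtain ⟨n, hn⟩ := hab.le
        cases n with
        | zero => exact absurd hn.symm hab.ne
        | succ n => exact ⟨n, hn⟩ }
  haveI : IsPredArchimedean V := { exists_pred_iterate_of_le := fun h => h }
  { α := V }

theorem toRootedTree_bot : (⊥ : P.toRootedTree) = P.root := rfl

theorem toRootedTree_pred (v : P.toRootedTree) : Order.pred v = P.parent v := rfl

end ParentMap

/-! ### Matching weight and matching rate -/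

/-- The trees with all leaves at depth `d` that embed in both `T` and `T'`. -/
def commonTrees (d : ℕ) (T T' : RootedTree.{0}) : Set RootedTree.{0} :=
  {t | AllLeavesAt d t ∧ (∃ f, IsEmbedding t T f) ∧ ∃ f', IsEmbedding t T' f'}

/-- The matching weight of `T` and `T'` at distance `d`: the largest number of leaves of a
tree with all leaves at depth `d` that embeds in both (`0` if there is no such tree). -/
def matchingWeight (d : ℕ) (T T' : RootedTree.{0}) : ℕ∞ :=
  ⨆ t ∈ commonTrees d T T', (level t d).encard

/-- The matching rate of a pair of random trees. The infimum is taken in the extended reals,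
so that it is `⊤` when no `γ` is admissible. -/
def matchingRate {Ω : Type*} [MeasurableSpace Ω] (μ : Measure Ω) (T T' : Ω → RootedTree.{0}) :
    EReal :=
  sInf ((fun γ : ℝ => (γ : EReal)) ''
    {γ : ℝ | ∃ m c : ℝ, ∃ d₀ : ℕ, 0 < m ∧ 0 < c ∧ 0 < d₀ ∧
      ∀ x : ℝ, 0 ≤ x → ∀ d : ℕ, d₀ ≤ d →
        μ {ω | ((m * x * γ ^ d : ℝ) : EReal) ≤
            (((matchingWeight d (T ω) (T' ω) : ℕ∞) : ℝ≥0∞) : EReal)}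
          ≤ ENNReal.ofReal (Real.exp (-(max (x - c) 0)))})

/-! ### The model of intersecting Galton-Watson trees -/

/-- The type of a vertex: in the intersection of the two trees, only in the first tree, or only
in the second tree. -/
inductive Kind
  | common
  | first
  | second

/-- The label of a vertex. `(k, [])` is the vertex at distance `k` from the root `ρ = (0, [])` of
the first tree on the path from `ρ` to `ρ' = (δ, [])`; `(k, (κ, n) :: w)` is the child number `n`
of type `κ` of the vertex `(k, w)`. -/
abbrev Label : Type := ℕ × List (Kind × ℕ)

/-- The type of the vertex with a given label: the vertices of the path before `ρ'` are only in
the first tree, and `ρ'` is in the intersection. -/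
def kindOf (δ : ℕ) : Label → Kind
  | (k, []) => if k < δ then Kind.first else Kind.common
  | (_, (κ, _) :: _) => κ

/-- The mean number of children of type `κ'` of a vertex of type `κ`. For a vertex of the path
before `ρ'`, the child leading to `ρ'` is not counted. -/
def offspringMean (lam s : ℝ) : (κ κ' : Kind) → ℝ
  | Kind.common, Kind.common => lam * s
  | Kind.common, Kind.first => lam * (1 - s)
  | Kind.common, Kind.second => lam * (1 - s)
  | Kind.first, Kind.first => lam
  | Kind.second, Kind.second => lam
  | _, _ => 0

/-- A realization of the randomness: the number of children of each type of every potential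
vertex. -/
abbrev Offspring : Type := Label × Kind → ℕ

/-- The law of the offspring numbers: independent Poisson variables. -/
def offspringLaw (lam s : ℝ) (δ : ℕ) : Measure Offspring :=
  Measure.infinitePi fun p : Label × Kind =>
    poissonMeasure (offspringMean lam s (kindOf δ p.1) p.2).toNNReal

/-- The vertices of the first tree. -/
def InFirst (δ : ℕ) (ω : Offspring) : Label → Prop
  | (k, []) => k ≤ δ
  | (k, (κ, n) :: w) => κ ≠ Kind.second ∧ n < ω ((k, w), κ) ∧ InFirst δ ω (k, w)

/-- The vertices of the second tree: the label `(δ, w)` is written `w`, so that the root `ρ'` is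
`[]`. -/
def InSecond (δ : ℕ) (ω : Offspring) : List (Kind × ℕ) → Prop
  | [] => True
  | (κ, n) :: w => κ ≠ Kind.first ∧ n < ω ((δ, w), κ) ∧ InSecond δ ω w

/-- The parent of a label in the first tree. -/
def parentLabel : Label → Label
  | (0, []) => (0, [])
  | (k + 1, []) => (k, [])
  | (k, _ :: w) => (k, w)

theorem inFirst_parentLabel {δ : ℕ} {ω : Offspring} :
    ∀ l : Label, InFirst δ ω l → InFirst δ ω (parentLabel l)
  | (0, []), h => h
  | (k + 1, []), h => by
      simp only [InFirst, parentLabel] at h ⊢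
      omega
  | (0, (_, _) :: _), h => by
      simp only [InFirst, parentLabel] at h ⊢
      exact h.2.2
  | (k + 1, (_, _) :: _), h => by
      simp only [InFirst, parentLabel] at h ⊢
      exact h.2.2

theorem parentLabel_cons (k : ℕ) (a : Kind × ℕ) (w : List (Kind × ℕ)) :
    parentLabel (k, a :: w) = (k, w) := by
  cases k <;> rfl

theorem exists_iterate_parentLabel (l : Label) : ∃ n : ℕ, parentLabel^[n] l = (0, []) := by
  obtain ⟨k, w⟩ := l
  induction w with
  | nil =>
    induction k with
    | zero => exact ⟨0, rfl⟩
    | succ k ih =>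
      obtain ⟨n, hn⟩ := ih
      exact ⟨n + 1, by rw [Function.iterate_succ_apply]; exact hn⟩
  | cons a w ih =>
    obtain ⟨n, hn⟩ := ih
    exact ⟨n + 1, by rw [Function.iterate_succ_apply, parentLabel_cons]; exact hn⟩

theorem inSecond_tail {δ : ℕ} {ω : Offspring} :
    ∀ w : List (Kind × ℕ), InSecond δ ω w → InSecond δ ω w.tail
  | [], h => h
  | (_, _) :: _, h => h.2.2

/-- The root `ρ` and the parents in the first tree. -/
def firstParentMap (δ : ℕ) (ω : Offspring) : ParentMap {l : Label // InFirst δ ω l} where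
  root := ⟨(0, []), by simp [InFirst]⟩
  parent l := ⟨parentLabel l.1, inFirst_parentLabel l.1 l.2⟩
  parent_root := rfl
  reaches l := by
    obtain ⟨n, hn⟩ := exists_iterate_parentLabel l.1
    refine ⟨n, Subtype.ext ?_⟩
    refine Eq.trans ?_ hn
    exact (Function.Semiconj.iterate_right (f := Subtype.val)
      (ga := fun l : {l : Label // InFirst δ ω l} =>
        ⟨parentLabel l.1, inFirst_parentLabel l.1 l.2⟩) (gb := parentLabel)
      (fun _ => rfl) n) l

/-- The first tree, rooted at `ρ`. -/
def firstTree (δ : ℕ) (ω : Offspring) : RootedTree.{0} := (firstParentMap δ ω).toRootedTree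

/-- The root `ρ'` and the parents in the second tree. -/
def secondParentMap (δ : ℕ) (ω : Offspring) :
    ParentMap {w : List (Kind × ℕ) // InSecond δ ω w} where
  root := ⟨[], trivial⟩
  parent w := ⟨w.1.tail, inSecond_tail w.1 w.2⟩
  parent_root := rfl
  reaches w := by
    obtain ⟨n, hn⟩ : ∃ n : ℕ, List.tail^[n] w.1 = [] := by
      induction w.1 with
      | nil => exact ⟨0, rfl⟩
      | cons a w ih =>
        obtain ⟨n, hn⟩ := ih
        exact ⟨n + 1, by rw [Function.iterate_succ_apply]; exact hn⟩
    refine ⟨n, Subtype.ext ?_⟩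
    refine Eq.trans ?_ hn
    exact (Function.Semiconj.iterate_right (f := Subtype.val)
      (ga := fun w : {w : List (Kind × ℕ) // InSecond δ ω w} =>
        ⟨w.1.tail, inSecond_tail w.1 w.2⟩) (gb := List.tail)
      (fun _ => rfl) n) w

/-- The second tree, rooted at `ρ'`. -/
def secondTree (δ : ℕ) (ω : Offspring) : RootedTree.{0} := (secondParentMap δ ω).toRootedTree

/-- The matching rate of the pair of intersecting trees of the model `GW(lam, s, δ)`. -/
def gwMatchingRate (lam s : ℝ) (δ : ℕ) : EReal :=
  matchingRate (offspringLaw lam s δ) (firstTree δ) (secondTree δ)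

end TreeMatching

end

/-!
For `lam = 1 + ε` with `0 < ε ≤ 1 / 200`, the rate `1 + 3 / 4 * ε` is admissible for all `s` and
all `δ ≥ 1`, whence the supremum over `δ` is at most `1 + 3 / 4 * ε < lam`.

*Recursive weight.* An embedded common tree matches the children of each vertex in the two trees,
so the matching weight is at most a weight `weight d` of the trees truncated at depth `d`, defined
by maximizing over the matchings of the children of the roots the sum of the weights of the matched
subtrees (`matchingWeight_le`). Under `offspringLaw`, the truncated trees have an explicit discrete
law (`blockLaw_truncTree`), on which expectations are computed with the Mecke formula for Poisson
lists (`expect_poissonList_pickSum`).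

*Independent trees.* Singling out one matched pair in `(∑ w) ^ p = ∑ w * (∑ w) ^ (p - 1)` and
applying the Mecke formula gives a recursive inequality for the moments of the weight
(`moment_succ_le`), whose leading term is `lam ^ 2` times the moment of the previous depth. For
`p = 3` the other terms involve two disjoint pairs of surviving subtrees, hence carry an additional
factor, the square of a survival probability of order `ε`. So the third moment is multiplied at each
step by `lam ^ 2 + O(ε ^ 2) = 1 + 2 * ε + O(ε ^ 2)`, which is less than `(1 + 3 / 4 * ε) ^ 3`: the
`L ^ 3` norm of the weight has a smaller growth rate than the trees. The recursive inequality then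
propagates this rate to all moments, with the constants `(A * p) ^ p` that correspond to exponential
tails (`exists_forall_le_of_recursive`, `exists_moment_le`).

*Intersecting trees.* The child of `ρ` that leads to `ρ'` is matched with at most one child of `ρ'`.
If this child `u` of `ρ'` is common to both trees, the pair of subtrees has the same law as the pair
of trees, by the Mecke formula (`expect_spineLaw_sum`); otherwise it is a pair of independent trees,
the first of which contains a path. The rest of the matching concerns independent Galton-Watson
trees. By Minkowski's inequality, used in the form of a convexity inequality in
`weight_cons_pow_le`, the `L ^ p` norm of the weight is thus multiplied at each step by at most
`lam ^ (1 / p)`, up to the additive contribution of independent trees. As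
`lam ^ (1 / p) ≤ lam ^ (1 / 3) < 1 + 3 / 4 * ε` for `p ≥ 3`, the rate of the independent case is
preserved, whatever `δ` (`exists_expect_spineLaw_le`). The Markov inequality with the moment of
order `⌊x⌋` gives the exponential tail of the definition (`gwMatchingRate_le`).
-/

noncomputable section

namespace TreeMatching

/-! ### Expectations over discrete laws -/

/-- The expectation of a nonnegative function under a discrete law. -/
def expect {α : Type*} (p : PMF α) (f : α → ℝ≥0∞) : ℝ≥0∞ := ∑' x, p x * f x

section Expect

variable {α β : Type*}

theorem expect_mono (p : PMF α) {f g : α → ℝ≥0∞} (h : ∀ x, f x ≤ g x) :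
    expect p f ≤ expect p g :=
  ENNReal.tsum_le_tsum fun x => by gcongr; exact h x

theorem expect_add (p : PMF α) (f g : α → ℝ≥0∞) :
    expect p (fun x => f x + g x) = expect p f + expect p g := by
  simp only [expect, mul_add, ENNReal.tsum_add]

theorem expect_const_mul (p : PMF α) (c : ℝ≥0∞) (f : α → ℝ≥0∞) :
    expect p (fun x => c * f x) = c * expect p f := by
  simp only [expect, ← ENNReal.tsum_mul_left]
  exact tsum_congr fun x => mul_left_comm _ _ _

theorem expect_mul_const (p : PMF α) (c : ℝ≥0∞) (f : α → ℝ≥0∞) :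
    expect p (fun x => f x * c) = expect p f * c := by
  simp only [expect, ← ENNReal.tsum_mul_right, mul_assoc]

@[simp] theorem expect_const (p : PMF α) (c : ℝ≥0∞) : expect p (fun _ => c) = c := by
  simp [expect, ENNReal.tsum_mul_right, p.tsum_coe]

theorem expect_finset_sum {ι : Type*} (p : PMF α) (s : Finset ι) (f : ι → α → ℝ≥0∞) :
    expect p (fun x => ∑ i ∈ s, f i x) = ∑ i ∈ s, expect p (f i) := by
  classical
  induction s using Finset.induction_on with
  | empty => simp
  | insert i s hi ih => simp only [Finset.sum_insert hi, expect_add, ih]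

theorem expect_comm (p : PMF α) (q : PMF β) (f : α → β → ℝ≥0∞) :
    expect p (fun x => expect q (f x)) = expect q (fun y => expect p (fun x => f x y)) := by
  simp only [expect, ← ENNReal.tsum_mul_left]
  rw [ENNReal.tsum_comm]
  exact tsum_congr fun y => tsum_congr fun x => mul_left_comm _ _ _

@[simp] theorem expect_pure (a : α) (f : α → ℝ≥0∞) : expect (PMF.pure a) f = f a := by
  classical
  rw [expect, tsum_eq_single a]
  · simp
  · intro b hb
    simp [PMF.pure_apply, hb]

theorem expect_bind (p : PMF α) (q : α → PMF β) (f : β → ℝ≥0∞) :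
    expect (p.bind q) f = expect p (fun x => expect (q x) f) := by
  simp only [expect, PMF.bind_apply, ← ENNReal.tsum_mul_left, ← ENNReal.tsum_mul_right]
  rw [ENNReal.tsum_comm]
  exact tsum_congr fun y => tsum_congr fun x => mul_assoc _ _ _

theorem expect_map (p : PMF α) (g : α → β) (f : β → ℝ≥0∞) :
    expect (p.map g) f = expect p (fun x => f (g x)) := by
  rw [← PMF.bind_pure_comp, expect_bind]
  simp

theorem expect_eq_of_forall {p q : PMF α} (h : ∀ f, expect p f = expect q f) : p = q := by
  classical
  ext a
  have := h (fun x => if x = a then 1 else 0)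
  simpa [expect] using this

end Expect

/-! ### Poisson lists -/

/-- The Poisson law as a discrete law. -/
def poisson (a : ℝ≥0) : PMF ℕ := (poissonMeasure a).toPMF

theorem expect_poisson_eq_lintegral (a : ℝ≥0) (f : ℕ → ℝ≥0∞) :
    expect (poisson a) f = ∫⁻ n, f n ∂poissonMeasure a := by
  rw [lintegral_countable']
  simp only [expect, poisson, Measure.toPMF_apply, mul_comm]

theorem expect_poisson_add (a b : ℝ≥0) (f : ℕ → ℝ≥0∞) :
    expect (poisson a) (fun m => expect (poisson b) (fun n => f (m + n)))
      = expect (poisson (a + b)) f := by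
  simp only [expect_poisson_eq_lintegral]
  rw [← poissonMeasure_conv_poissonMeasure, Measure.lintegral_conv (by fun_prop)]

theorem poisson_apply (a : ℝ≥0) (n : ℕ) :
    poisson a n = ENNReal.ofReal (Real.exp (-a) * a ^ n / n.factorial) := by
  rw [poisson, Measure.toPMF_apply, poissonMeasure_singleton]

theorem poisson_succ (a : ℝ≥0) (n : ℕ) :
    (n + 1 : ℕ) * poisson a (n + 1) = a * poisson a n := by
  rw [poisson_apply, poisson_apply, ← ENNReal.ofReal_natCast, ← ENNReal.ofReal_coe_nnreal,
    ← ENNReal.ofReal_mul (by positivity), ← ENNReal.ofReal_mul (by positivity)]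
  congr 1
  rw [Nat.factorial_succ]
  push_cast
  field_simp
  ring

/-- The generating function of the Poisson law. -/
theorem expect_poisson_pow (a u : ℝ≥0) :
    expect (poisson a) (fun n => (u : ℝ≥0∞) ^ n) = ENNReal.ofReal (Real.exp (-a + a * u)) := by
  have h : ∀ n, poisson a n * (u : ℝ≥0∞) ^ n
      = ENNReal.ofReal (Real.exp (-a) * ((a * u) ^ n / n.factorial)) := by
    intro n
    rw [poisson_apply, ← ENNReal.ofReal_coe_nnreal, ← ENNReal.ofReal_pow (by positivity),
      ← ENNReal.ofReal_mul (by positivity)]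
    congr 1
    rw [mul_pow]
    ring
  have hs : HasSum (fun n : ℕ => ((a * u : ℝ) ^ n / n.factorial)) (Real.exp (a * u)) := by
    rw [Real.exp_eq_exp_ℝ]
    exact NormedSpace.expSeries_div_hasSum_exp _
  rw [expect, tsum_congr h, ← ENNReal.ofReal_tsum_of_nonneg (fun n => by positivity)
    (hs.mul_left _).summable, (hs.mul_left _).tsum_eq, Real.exp_add]

section Lists

variable {α β : Type*}

/-- The law of a list of `m` independent elements. -/
def iidList (p : PMF α) : ℕ → PMF (List α)
  | 0 => PMF.pure []
  | m + 1 => p.bind fun x => (iidList p m).map (List.cons x)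

theorem expect_iidList_zero (p : PMF α) (f : List α → ℝ≥0∞) :
    expect (iidList p 0) f = f [] := by
  simp [iidList]

theorem expect_iidList_succ (p : PMF α) (m : ℕ) (f : List α → ℝ≥0∞) :
    expect (iidList p (m + 1)) f
      = expect p (fun x => expect (iidList p m) (fun l => f (x :: l))) := by
  simp only [iidList, expect_bind, expect_map]

/-- The law of a list of independent elements of Poisson length. -/
def poissonList (a : ℝ≥0) (p : PMF α) : PMF (List α) := (poisson a).bind (iidList p)

theorem expect_poissonList (a : ℝ≥0) (p : PMF α) (f : List α → ℝ≥0∞) :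
    expect (poissonList a p) f = expect (poisson a) (fun m => expect (iidList p m) f) :=
  expect_bind _ _ _

theorem iidList_apply (p : PMF α) (m : ℕ) (l : List α) :
    iidList p m l = if m = l.length then (l.map p).prod else 0 := by
  classical
  induction m generalizing l with
  | zero => cases l <;> simp [iidList]
  | succ m ih =>
    have h1 : iidList p (m + 1) l
        = expect (iidList p (m + 1)) (fun l' => if l' = l then 1 else 0) := by
      simp [expect]
    rw [h1, expect_iidList_succ]
    cases l with
    | nil => simp
    | cons x l =>
      have h2 : ∀ y, expect (iidList p m) (fun l' => if y :: l' = x :: l then 1 else 0)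
          = if y = x then iidList p m l else 0 := by
        intro y
        by_cases hy : y = x
        · simp [expect, hy]
        · simp [hy]
      simp only [h2, ih]
      simp [expect]

theorem poissonList_apply (a : ℝ≥0) (p : PMF α) (l : List α) :
    poissonList a p l = poisson a l.length * (l.map p).prod := by
  rw [poissonList, PMF.bind_apply, tsum_eq_single l.length]
  · simp [iidList_apply]
  · intro m hm
    simp [iidList_apply, hm]

theorem expect_iidList_append (p : PMF α) (m n : ℕ) (f : List α → ℝ≥0∞) :
    expect (iidList p m) (fun l => expect (iidList p n) (fun l' => f (l ++ l')))
      = expect (iidList p (m + n)) f := by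
  induction m generalizing f with
  | zero => simp [expect_iidList_zero]
  | succ m ih =>
    rw [Nat.add_right_comm, expect_iidList_succ, expect_iidList_succ]
    simp only [List.cons_append]
    congr 1
    funext x
    exact ih (fun l => f (x :: l))

/-- Superposition of Poisson lists. -/
theorem expect_poissonList_append (a b : ℝ≥0) (p : PMF α) (f : List α → ℝ≥0∞) :
    expect (poissonList a p) (fun l => expect (poissonList b p) (fun l' => f (l ++ l')))
      = expect (poissonList (a + b) p) f := by
  rw [expect_poissonList, expect_poissonList, ← expect_poisson_add]
  congr 1
  funext m
  simp only [expect_poissonList]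
  rw [expect_comm]
  congr 1
  funext n
  exact expect_iidList_append p m n f

theorem iidList_map (p : PMF α) (g : α → β) (m : ℕ) :
    (iidList p m).map (List.map g) = iidList (p.map g) m := by
  induction m with
  | zero => simp [iidList, PMF.pure_map]
  | succ m ih =>
    refine expect_eq_of_forall fun f => ?_
    rw [expect_map, expect_iidList_succ, expect_iidList_succ, expect_map]
    congr 1
    funext x
    rw [← ih, expect_map]
    rfl

theorem expect_poissonList_map (a : ℝ≥0) (p : PMF α) (g : α → β) (f : List β → ℝ≥0∞) :
    expect (poissonList a p) (fun l => f (l.map g)) = expect (poissonList a (p.map g)) f := by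
  simp only [expect_poissonList]
  congr 1
  funext m
  rw [← iidList_map, expect_map]

/-- The sum over the elements of a list of a function of the element and of the list of the other
elements. -/
def pickSum : List α → (α → List α → ℝ≥0∞) → ℝ≥0∞
  | [], _ => 0
  | x :: l, F => F x l + pickSum l (fun y l' => F y (x :: l'))

theorem expect_iidList_pickSum (p : PMF α) (m : ℕ) (F : α → List α → ℝ≥0∞) :
    expect (iidList p (m + 1)) (fun l => pickSum l F)
      = (m + 1 : ℕ) * expect p (fun x => expect (iidList p m) (F x)) := by
  induction m generalizing F with
  | zero => simp [expect_iidList_succ, expect_iidList_zero, pickSum]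
  | succ m ih =>
    rw [expect_iidList_succ]
    simp only [pickSum, expect_add, ih, expect_const_mul]
    simp only [expect_iidList_succ]
    rw [expect_comm p p]
    push_cast
    ring

/-- The Mecke formula for Poisson lists: seen from an element picked in the list, the other elements
form a Poisson list of the same law. -/
theorem expect_poissonList_pickSum (a : ℝ≥0) (p : PMF α) (F : α → List α → ℝ≥0∞) :
    expect (poissonList a p) (fun l => pickSum l F)
      = a * expect p (fun x => expect (poissonList a p) (F x)) := by
  simp only [expect_poissonList]
  rw [expect_comm, expect, expect, tsum_eq_zero_add' ENNReal.summable]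
  simp only [expect_iidList_pickSum]
  rw [← ENNReal.tsum_mul_left, expect_iidList_zero]
  simp only [pickSum, mul_zero, zero_add]
  refine tsum_congr fun m => ?_
  rw [mul_left_comm, ← mul_assoc, poisson_succ, mul_assoc]

theorem expect_iidList_prod (p : PMF α) (m : ℕ) (g : α → ℝ≥0∞) :
    expect (iidList p m) (fun l => (l.map g).prod) = expect p g ^ m := by
  induction m with
  | zero => simp [expect_iidList_zero]
  | succ m ih =>
    rw [expect_iidList_succ]
    simp only [List.map_cons, List.prod_cons, expect_const_mul, ih, expect_mul_const]
    rw [pow_succ']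

open Classical in
theorem pickSum_coe (l : List α) (G : α → Multiset α → ℝ≥0∞) :
    pickSum l (fun y l' => G y (l' : Multiset α))
      = ((l : Multiset α).map (fun y => G y ((l : Multiset α).erase y))).sum := by
  induction l generalizing G with
  | nil => simp [pickSum]
  | cons x l ih =>
    rw [pickSum]
    have h1 := ih (fun y M => G y (x ::ₘ M))
    simp only [← Multiset.cons_coe, Multiset.map_cons, Multiset.sum_cons, Multiset.erase_cons_head]
    simp only [Multiset.cons_coe] at h1 ⊢
    simp only [← Multiset.cons_coe] at h1 ⊢
    rw [h1]
    congr 2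
    refine Multiset.map_congr rfl fun y hy => ?_
    congr 1
    by_cases hxy : x = y
    · subst hxy
      rw [Multiset.cons_erase hy, Multiset.erase_cons_head]
    · rw [Multiset.erase_cons_tail _ (by simpa using hxy)]

end Lists

/-! ### Truncated trees and their matching weight -/

/-- The unordered rooted trees truncated at depth `d`: such a tree is the multiset of the subtrees
at the children of its root. -/
abbrev TruncTree : ℕ → Type
  | 0 => Unit
  | d + 1 => Multiset (TruncTree d)

/-- The multisets of pairs that match some elements of `M` with some elements of `M'`. -/
def IsMatching {α : Type*} (M M' : Multiset α) (P : Multiset (α × α)) : Prop :=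
  P.map Prod.fst ≤ M ∧ P.map Prod.snd ≤ M'

/-- The matching weight of truncated trees, defined recursively: the children of the roots are
matched so as to maximize the sum of the weights of the matched subtrees. -/
def weight : (d : ℕ) → TruncTree d → TruncTree d → ℝ≥0∞
  | 0, _, _ => 1
  | d + 1, M, M' => ⨆ (P : Multiset (TruncTree d × TruncTree d)) (_ : IsMatching M M' P),
      (P.map fun e => weight d e.1 e.2).sum

theorem sum_le_weight {d : ℕ} {M M' : Multiset (TruncTree d)}
    {P : Multiset (TruncTree d × TruncTree d)} (h : IsMatching M M' P) :
    (P.map fun e => weight d e.1 e.2).sum ≤ weight (d + 1) M M' :=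
  le_iSup₂_of_le P h le_rfl

theorem weight_pow_le {d : ℕ} {M M' : Multiset (TruncTree d)} {p : ℕ} (hp : p ≠ 0) {B : ℝ≥0∞}
    (h : ∀ P, IsMatching M M' P → (P.map fun e => weight d e.1 e.2).sum ^ p ≤ B) :
    weight (d + 1) M M' ^ p ≤ B := by
  have hp' : (0 : ℝ) < p := by positivity
  rw [← ENNReal.rpow_natCast, ← ENNReal.le_rpow_inv_iff hp']
  refine iSup₂_le fun P hP => ?_
  rw [ENNReal.le_rpow_inv_iff hp', ENNReal.rpow_natCast]
  exact h P hP

theorem multiset_sum_map_le_of_le {α : Type*} {M N : Multiset α} (h : M ≤ N) (f : α → ℝ≥0∞) :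
    (M.map f).sum ≤ (N.map f).sum := by
  obtain ⟨K, rfl⟩ := Multiset.le_iff_exists_add.mp h
  simp

theorem IsMatching.sum_le {α : Type*} {M M' : Multiset α} {P : Multiset (α × α)}
    (h : IsMatching M M' P) (f : α → α → ℝ≥0∞) :
    (P.map fun e => f e.1 e.2).sum ≤ (M.map fun x => (M'.map fun y => f x y).sum).sum := by
  calc (P.map fun e => f e.1 e.2).sum
      ≤ (P.map fun e => (M'.map fun y => f e.1 y).sum).sum := by
        refine Multiset.sum_map_le_sum_map _ _ fun e he => ?_
        refine Multiset.single_le_sum (fun _ _ => zero_le) _ ?_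
        exact Multiset.mem_map_of_mem _
          (Multiset.mem_of_le h.2 (Multiset.mem_map_of_mem Prod.snd he))
    _ = ((P.map Prod.fst).map fun x => (M'.map fun y => f x y).sum).sum := by
        rw [Multiset.map_map]
        rfl
    _ ≤ _ := multiset_sum_map_le_of_le h.1 _

open Classical in
theorem IsMatching.erase {α : Type*} {M M' : Multiset α} {P : Multiset (α × α)}
    (h : IsMatching M M' P) {e : α × α} (he : e ∈ P) :
    IsMatching (M.erase e.1) (M'.erase e.2) (P.erase e) := by
  constructor
  · rw [Multiset.map_erase_of_mem _ _ he]
    exact Multiset.erase_le_erase _ h.1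
  · rw [Multiset.map_erase_of_mem _ _ he]
    exact Multiset.erase_le_erase _ h.2

open Classical in
/-- Singling out one matched pair in one factor of the power: the other pairs form a matching of
the remaining children. -/
theorem weight_pow_succ_le (d p : ℕ) (M M' : Multiset (TruncTree d)) :
    weight (d + 1) M M' ^ (p + 1) ≤ (M.map fun x => (M'.map fun y =>
      weight d x y * (weight d x y + weight (d + 1) (M.erase x) (M'.erase y)) ^ p).sum).sum := by
  refine weight_pow_le (Nat.succ_ne_zero p) fun P hP => ?_
  refine le_trans ?_ (hP.sum_le _)
  rw [pow_succ', ← Multiset.sum_map_mul_right]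
  refine Multiset.sum_map_le_sum_map _ _ fun e he => ?_
  gcongr
  rw [← Multiset.cons_erase he, Multiset.map_cons, Multiset.sum_cons]
  gcongr
  exact sum_le_weight (hP.erase he)

theorem IsMatching.of_cons {α : Type*} {x : α} {M M' : Multiset α} {P : Multiset (α × α)}
    (h : IsMatching (x ::ₘ M) M' P) :
    IsMatching M M' P ∨ ∃ y ∈ M', ∃ P', P = (x, y) ::ₘ P' ∧ IsMatching M M' P' := by
  by_cases hx : x ∈ P.map Prod.fst
  · right
    obtain ⟨e, he, rfl⟩ := Multiset.mem_map.mp hx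
    obtain ⟨P', rfl⟩ := Multiset.exists_cons_of_mem he
    obtain ⟨h1, h2⟩ := h
    rw [Multiset.map_cons] at h1 h2
    exact ⟨e.2, Multiset.mem_of_le h2 (Multiset.mem_cons_self _ _), P', rfl,
      (Multiset.cons_le_cons_iff _).mp h1, le_trans (Multiset.le_cons_self _ _) h2⟩
  · left
    exact ⟨(Multiset.le_cons_of_notMem hx).mp h.1, h.2⟩

/-- Convexity of the power function, for the weights `1 - t` and `t`. Optimizing over `t` would give
Minkowski's inequality. -/
theorem add_pow_le_of_convex {t : ℝ≥0} (ht : 0 < t) (ht1 : t < 1) (x y : ℝ≥0∞) {p : ℕ}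
    (hp : 1 ≤ p) :
    (x + y) ^ p ≤ ((1 - t : ℝ≥0) : ℝ≥0∞) * ((1 - t)⁻¹ : ℝ≥0) ^ p * x ^ p
      + (t : ℝ≥0∞) * (t⁻¹ : ℝ≥0) ^ p * y ^ p := by
  have h1 : (0 : ℝ≥0) < 1 - t := tsub_pos_of_lt ht1
  have h := ENNReal.rpow_arith_mean_le_arith_mean2_rpow ((1 - t : ℝ≥0) : ℝ≥0∞) t
    (((1 - t)⁻¹ : ℝ≥0) * x) ((t⁻¹ : ℝ≥0) * y)
    (by rw [← ENNReal.coe_add, tsub_add_cancel_of_le ht1.le, ENNReal.coe_one])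
    (p := p) (by exact_mod_cast hp)
  rw [← mul_assoc, ← mul_assoc, ← ENNReal.coe_mul, ← ENNReal.coe_mul, mul_inv_cancel₀ h1.ne',
    mul_inv_cancel₀ ht.ne', ENNReal.coe_one, one_mul, one_mul] at h
  simpa only [ENNReal.rpow_natCast, mul_pow, mul_assoc] using h

/-- Separating one child of the first root. -/
theorem weight_cons_pow_le {t : ℝ≥0} (ht : 0 < t) (ht1 : t < 1) {d p : ℕ} (hp : 1 ≤ p)
    (x : TruncTree d) (M M' : Multiset (TruncTree d)) :
    weight (d + 1) (x ::ₘ M : Multiset (TruncTree d)) M' ^ p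
      ≤ ((1 - t : ℝ≥0) : ℝ≥0∞) * ((1 - t)⁻¹ : ℝ≥0) ^ p * weight (d + 1) M M' ^ p
        + (t : ℝ≥0∞) * (t⁻¹ : ℝ≥0) ^ p * (M'.map fun y => weight d x y ^ p).sum := by
  refine weight_pow_le (by omega) fun P hP => ?_
  rcases hP.of_cons with h | ⟨y, hy, P', rfl, h⟩
  · refine le_trans ?_ (le_trans (add_pow_le_of_convex ht ht1 (weight (d + 1) M M') 0 hp) ?_)
    · rw [add_zero]
      gcongr
      exact sum_le_weight h
    · rw [zero_pow (by omega), mul_zero]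
      gcongr
      exact zero_le
  · rw [Multiset.map_cons, Multiset.sum_cons, add_comm]
    refine (add_pow_le_of_convex ht ht1 _ _ hp).trans ?_
    gcongr
    · exact sum_le_weight h
    · exact Multiset.single_le_sum (fun _ _ => zero_le) _
        (Multiset.mem_map_of_mem (fun y => weight d x y ^ p) hy)

/-- Indicator (with values `0` and `1`) that a truncated tree does not reach depth `d`. -/
def dead : (d : ℕ) → TruncTree d → ℝ≥0∞
  | 0, _ => 0
  | d + 1, M => (Multiset.map (dead d) M).prod

theorem dead_eq_zero_or_one (d : ℕ) (t : TruncTree d) : dead d t = 0 ∨ dead d t = 1 := by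
  induction d with
  | zero => exact Or.inl rfl
  | succ d ih =>
    induction t using Multiset.induction with
    | empty => exact Or.inr (by simp [dead])
    | cons x M hM =>
      rw [dead] at hM ⊢
      rw [Multiset.map_cons, Multiset.prod_cons]
      rcases ih x with h | h <;> rcases hM with h' | h' <;> simp [h, h']

/-- The weight vanishes unless both trees reach depth `d`. -/
theorem weight_eq_zero_of_dead (d : ℕ) (t t' : TruncTree d) (h : dead d t = 1 ∨ dead d t' = 1) :
    weight d t t' = 0 := by
  induction d with
  | zero => simp [dead] at h
  | succ d ih =>
    have hmem : ∀ M : Multiset (TruncTree d), dead (d + 1) M = 1 → ∀ x ∈ M, dead d x = 1 := by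
      intro M hM x hx
      rcases dead_eq_zero_or_one d x with h0 | h1
      · have : dead (d + 1) M = 0 := by
          rw [dead]
          exact Multiset.prod_eq_zero (h0 ▸ Multiset.mem_map_of_mem _ hx)
        rw [this] at hM
        exact absurd hM zero_ne_one
      · exact h1
    rw [weight]
    refine le_antisymm (iSup₂_le fun P hP => ?_) zero_le
    refine (Multiset.sum_eq_zero fun w hw => ?_).le
    obtain ⟨e, he, rfl⟩ := Multiset.mem_map.mp hw
    refine ih _ _ (h.imp (fun h => ?_) (fun h => ?_))
    · exact hmem t h _ (Multiset.mem_of_le hP.1 (Multiset.mem_map_of_mem Prod.fst he))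
    · exact hmem t' h _ (Multiset.mem_of_le hP.2 (Multiset.mem_map_of_mem Prod.snd he))

/-! ### Moments of the matching weight of independent Galton-Watson trees -/

/-- The law of a Galton-Watson tree with Poisson offspring truncated at depth `d`. -/
def gwLaw (a : ℝ≥0) : (d : ℕ) → PMF (TruncTree d)
  | 0 => PMF.pure ()
  | d + 1 => (poissonList a (gwLaw a d)).map Multiset.ofList

theorem expect_gwLaw_succ (a : ℝ≥0) (d : ℕ) (f : Multiset (TruncTree d) → ℝ≥0∞) :
    expect (gwLaw a (d + 1)) f
      = expect (poissonList a (gwLaw a d)) (fun l => f (l : Multiset (TruncTree d))) := by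
  exact expect_map (poissonList a (gwLaw a d)) Multiset.ofList f

open Classical in
/-- The Mecke formula for the children of the root of a Galton-Watson tree. -/
theorem expect_gwLaw_succ_sum_erase (a : ℝ≥0) (d : ℕ)
    (G : TruncTree d → Multiset (TruncTree d) → ℝ≥0∞) :
    expect (gwLaw a (d + 1))
        (fun M : Multiset (TruncTree d) => (M.map fun x => G x (M.erase x)).sum)
      = a * expect (gwLaw a d) (fun x => expect (gwLaw a (d + 1)) (G x)) := by
  rw [expect_gwLaw_succ]
  simp only [← pickSum_coe]
  rw [expect_poissonList_pickSum]
  congr 2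
  funext x
  exact (expect_gwLaw_succ a d (G x)).symm

theorem expect_gwLaw_succ_sum (a : ℝ≥0) (d : ℕ) (g : TruncTree d → ℝ≥0∞) :
    expect (gwLaw a (d + 1)) (fun M : Multiset (TruncTree d) => (M.map g).sum)
      = a * expect (gwLaw a d) g := by
  classical
  simpa using expect_gwLaw_succ_sum_erase a d (fun x _ => g x)

/-- The moments of the matching weight of two independent Galton-Watson trees. -/
def moment (a : ℝ≥0) (p d : ℕ) : ℝ≥0∞ :=
  expect (gwLaw a d) fun t => expect (gwLaw a d) fun t' => weight d t t' ^ p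

theorem moment_zero_left (a : ℝ≥0) (d : ℕ) : moment a 0 d = 1 := by simp [moment]

theorem moment_zero_right (a : ℝ≥0) (p : ℕ) : moment a p 0 = 1 := by
  simp [moment, weight]

open Classical in
theorem expect_sum_sum_erase (a : ℝ≥0) (d : ℕ)
    (G : TruncTree d → TruncTree d → Multiset (TruncTree d) → Multiset (TruncTree d) → ℝ≥0∞) :
    expect (gwLaw a (d + 1)) (fun M : Multiset (TruncTree d) =>
        expect (gwLaw a (d + 1)) (fun M' : Multiset (TruncTree d) =>
          (M.map fun x => (M'.map fun y => G x y (M.erase x) (M'.erase y)).sum).sum))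
      = a ^ 2 * expect (gwLaw a d) (fun x => expect (gwLaw a d) (fun y =>
          expect (gwLaw a (d + 1)) (fun M => expect (gwLaw a (d + 1)) (fun M' => G x y M M')))) := by
  have hsum : ∀ (M : Multiset (TruncTree d)) (g : TruncTree d → Multiset (TruncTree d) → ℝ≥0∞),
      expect (gwLaw a (d + 1)) (fun M' : Multiset (TruncTree d) => (M.map fun x => g x M').sum)
        = (M.map fun x => expect (gwLaw a (d + 1)) (g x)).sum := by
    intro M g
    induction M using Multiset.induction with
    | empty => simp
    | cons x M ih => simp only [Multiset.map_cons, Multiset.sum_cons, expect_add, ih]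
  have h2 : ∀ M x, expect (gwLaw a (d + 1)) (fun M' : Multiset (TruncTree d) =>
      (M'.map fun y => G x y M (M'.erase y)).sum) = _ :=
    fun M x => expect_gwLaw_succ_sum_erase a d (fun y N' => G x y M N')
  simp only [hsum, h2]
  rw [expect_gwLaw_succ_sum_erase a d (fun x N => a * expect (gwLaw a d) (fun y =>
    expect (gwLaw a (d + 1)) (fun M' => G x y N M')))]
  simp only [expect_const_mul]
  rw [← mul_assoc, ← sq]
  congr 2
  funext x
  rw [expect_comm]

/-- The recursive inequality between moments. -/
theorem moment_succ_le (a : ℝ≥0) (p d : ℕ) :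
    moment a (p + 1) (d + 1) ≤ a ^ 2 * ∑ k ∈ Finset.range (p + 1),
      (p.choose k : ℝ≥0∞) * (moment a (k + 1) d * moment a (p - k) (d + 1)) := by
  classical
  have h1 : moment a (p + 1) (d + 1) ≤ _ :=
    expect_mono _ fun M => expect_mono _ fun M' => weight_pow_succ_le d p M M'
  refine h1.trans (le_of_eq ?_)
  rw [expect_sum_sum_erase a d (fun x y N N' =>
    weight d x y * (weight d x y + weight (d + 1) N N') ^ p)]
  congr 1
  simp only [add_pow, Finset.mul_sum, expect_finset_sum]
  refine Finset.sum_congr rfl fun k hk => ?_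
  simp only [mul_assoc, expect_const_mul, expect_mul_const, moment]
  simp only [← mul_assoc, ← pow_succ', expect_mul_const]
  ring

/-- All moments are finite, by the recursive inequality, whose right-hand side involves only moments
of a smaller depth or order. -/
theorem moment_ne_top (a : ℝ≥0) (p d : ℕ) : moment a p d ≠ ⊤ := by
  induction d generalizing p with
  | zero => simp [moment_zero_right]
  | succ d ihd =>
    induction p using Nat.strong_induction_on with
    | _ p ihp =>
      cases p with
      | zero => simp [moment_zero_left]
      | succ p =>
        refine ne_top_of_le_ne_top ?_ (moment_succ_le a p d)
        refine ENNReal.mul_ne_top (by simp) (ENNReal.sum_ne_top.mpr fun k hk => ?_)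
        exact ENNReal.mul_ne_top (by simp) (ENNReal.mul_ne_top (ihd _) (ihp _ (by omega)))

/-- The probability that a Galton-Watson tree does not reach depth `d`. -/
def extinctProb (a : ℝ≥0) (d : ℕ) : ℝ≥0∞ := expect (gwLaw a d) (dead d)

theorem extinctProb_le_one (a : ℝ≥0) (d : ℕ) : extinctProb a d ≤ 1 := by
  refine (expect_mono (gwLaw a d) (g := fun _ => 1) fun t => ?_).trans (by simp)
  rcases dead_eq_zero_or_one d t with h | h <;> simp [h]

theorem extinctProb_succ (a : ℝ≥0) (d : ℕ) :
    extinctProb a (d + 1)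
      = ENNReal.ofReal (Real.exp (-a + a * (extinctProb a d).toReal)) := by
  have h : extinctProb a d = ((extinctProb a d).toNNReal : ℝ≥0∞) :=
    (ENNReal.coe_toNNReal (ne_top_of_le_ne_top ENNReal.one_ne_top (extinctProb_le_one a d))).symm
  have h2 : extinctProb a (d + 1) = expect (poisson a) (fun m => extinctProb a d ^ m) := by
    rw [extinctProb, extinctProb, expect_gwLaw_succ, expect_poissonList]
    congr 1
    funext m
    rw [← expect_iidList_prod]
    rfl
  rw [h2, h, expect_poisson_pow]
  rfl

theorem expect_dead_compl (a : ℝ≥0) (d : ℕ) :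
    expect (gwLaw a d) (fun t => 1 - dead d t) + extinctProb a d = 1 := by
  rw [extinctProb, ← expect_add]
  rw [← expect_const (gwLaw a d) 1]
  congr 1
  funext t
  rcases dead_eq_zero_or_one d t with h | h <;> simp [h]

theorem expect_dead_compl_eq (a : ℝ≥0) (d : ℕ) :
    expect (gwLaw a d) (fun t => 1 - dead d t) = 1 - extinctProb a d :=
  ENNReal.eq_sub_of_add_eq (ne_top_of_le_ne_top ENNReal.one_ne_top (extinctProb_le_one a d))
    (expect_dead_compl a d)

/-- Mixed moments of independent pairs: both weights have to be nonzero, which gains the square of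
the survival probability. -/
theorem three_mul_moment_two_mul_moment_one_le (a : ℝ≥0) (d e : ℕ) :
    3 * (moment a 2 d * moment a 1 e) ≤
      2 * (moment a 3 d * (1 - extinctProb a e) ^ 2)
        + moment a 3 e * (1 - extinctProb a d) ^ 2 := by
  have hy : ∀ x y : ℝ≥0∞, 3 * (x ^ 2 * y) ≤ 2 * x ^ 3 + y ^ 3 := by
    intro x y
    rcases eq_or_ne x ⊤ with rfl | hx
    · simp
    rcases eq_or_ne y ⊤ with rfl | hy
    · simp
    lift x to ℝ≥0 using hx
    lift y to ℝ≥0 using hy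
    norm_cast
    rw [← NNReal.coe_le_coe]
    push_cast
    have hx := x.coe_nonneg
    have hy := y.coe_nonneg
    nlinarith [mul_nonneg (add_nonneg (add_nonneg hx hx) hy) (sq_nonneg ((x : ℝ) - y))]
  have key : ∀ (x x' : TruncTree d) (y y' : TruncTree e),
      3 * (weight d x x' ^ 2 * weight e y y')
        ≤ 2 * (weight d x x' ^ 3 * ((1 - dead e y) * (1 - dead e y')))
          + weight e y y' ^ 3 * ((1 - dead d x) * (1 - dead d x')) := by
    intro x x' y y'
    have hw := weight_eq_zero_of_dead d x x'
    have hw' := weight_eq_zero_of_dead e y y'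
    rcases dead_eq_zero_or_one d x with h1 | h1 <;>
    rcases dead_eq_zero_or_one d x' with h2 | h2 <;>
    rcases dead_eq_zero_or_one e y with h3 | h3 <;>
    rcases dead_eq_zero_or_one e y' with h4 | h4 <;>
    simp [h1, h2, h3, h4] at hw hw' ⊢ <;> simp [*]
  have h := expect_mono (gwLaw a d) fun x => expect_mono (gwLaw a d) fun x' =>
    expect_mono (gwLaw a e) fun y => expect_mono (gwLaw a e) fun y' => key x x' y y'
  simp only [expect_add, expect_const_mul, expect_mul_const,
    expect_dead_compl_eq] at h
  simp only [moment, pow_one, sq (1 - extinctProb a _)] at h ⊢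
  exact h

/-! ### Moment sequences governed by the recursive inequality -/

theorem sum_range_inv_sq_le (n : ℕ) : ∑ k ∈ Finset.range n, 1 / ((k + 1 : ℕ) : ℝ) ^ 2 ≤ 2 := by
  have h := sum_Ioo_inv_sq_le (α := ℝ) 0 (n + 1)
  have h2 : Finset.Ioo 0 (n + 1) = (Finset.range n).image (· + 1) := by
    ext i
    simp only [Finset.mem_Ioo, Finset.mem_image, Finset.mem_range]
    exact ⟨fun h => ⟨i - 1, by omega, by omega⟩, fun ⟨j, h1, h2⟩ => by omega⟩
  rw [h2, Finset.sum_image (by simp)] at h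
  simpa using h

/-- The sequence `1 / n ^ 2` is stable under convolution, up to a constant. -/
theorem sum_convolution_inv_sq_le (p : ℕ) :
    ∑ k ∈ Finset.range p, ((k + 1 : ℕ) : ℝ) / ((p + 1 : ℕ) : ℝ) *
      (1 / ((k + 1 : ℕ) : ℝ) ^ 2 * (1 / ((p - k : ℕ) : ℝ) ^ 2)) ≤ 4 / ((p + 1 : ℕ) : ℝ) ^ 2 := by
  have hrefl : ∑ k ∈ Finset.range p, 1 / ((p - k : ℕ) : ℝ) ^ 2
      = ∑ k ∈ Finset.range p, 1 / ((k + 1 : ℕ) : ℝ) ^ 2 := by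
    rw [← Finset.sum_range_reflect]
    refine Finset.sum_congr rfl fun k hk => ?_
    have := Finset.mem_range.mp hk
    rw [show p - (p - 1 - k) = k + 1 by omega]
  have hterm : ∀ k ∈ Finset.range p, ((k + 1 : ℕ) : ℝ) / ((p + 1 : ℕ) : ℝ) *
      (1 / ((k + 1 : ℕ) : ℝ) ^ 2 * (1 / ((p - k : ℕ) : ℝ) ^ 2))
      ≤ 1 / ((p + 1 : ℕ) : ℝ) ^ 2 * (1 / 2 * (1 / ((k + 1 : ℕ) : ℝ) ^ 2)
        + 3 / 2 * (1 / ((p - k : ℕ) : ℝ) ^ 2)) := by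
    intro k hk
    have hk := Finset.mem_range.mp hk
    obtain ⟨m, rfl⟩ : ∃ m, p = k + (m + 1) := ⟨p - k - 1, by omega⟩
    rw [show k + (m + 1) - k = m + 1 by omega]
    have hx : (0 : ℝ) < ((k + 1 : ℕ) : ℝ) := by positivity
    have hy : (0 : ℝ) < ((m + 1 : ℕ) : ℝ) := by positivity
    have hn : ((k + (m + 1) + 1 : ℕ) : ℝ) = ((k + 1 : ℕ) : ℝ) + ((m + 1 : ℕ) : ℝ) := by
      push_cast
      ring
    rw [hn]
    generalize ((k + 1 : ℕ) : ℝ) = x at *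
    generalize ((m + 1 : ℕ) : ℝ) = y at *
    have e : 1 / (x + y) ^ 2 * (1 / 2 * (1 / x ^ 2) + 3 / 2 * (1 / y ^ 2))
        - x / (x + y) * (1 / x ^ 2 * (1 / y ^ 2))
        = 1 / (x + y) ^ 2 * (1 / 2 * (1 / x - 1 / y) ^ 2) := by
      field_simp
      ring
    have : 0 ≤ 1 / (x + y) ^ 2 * (1 / 2 * (1 / x - 1 / y) ^ 2) := by positivity
    linarith
  refine (Finset.sum_le_sum hterm).trans ?_
  rw [← Finset.mul_sum, Finset.sum_add_distrib, ← Finset.mul_sum, ← Finset.mul_sum, hrefl]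
  have := sum_range_inv_sq_le p
  rw [show 4 / ((p + 1 : ℕ) : ℝ) ^ 2 = 1 / ((p + 1 : ℕ) : ℝ) ^ 2 * 4 by ring]
  gcongr
  linarith

/-- If a double sequence satisfies the recursive inequality of the moments, and its first two rows
grow at rate `gam` and `gam ^ 2` with `lam ^ 2 < gam ^ 3`, then the row `p` grows at rate
`gam ^ p` for every `p`, with a constant that is sharp enough for exponential tails. -/
theorem exists_forall_le_of_recursive {lam gam : ℝ} (hgam : 1 ≤ gam) (hlam : 1 ≤ lam)
    (hlg : lam ^ 2 < gam ^ 3) {α : ℕ → ℕ → ℝ} (hα : ∀ p d, 0 ≤ α p d) (h0 : ∀ d, α 0 d = 1)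
    (hp0 : ∀ p, α p 0 = 1)
    (hrec : ∀ p d, α (p + 1) (d + 1) ≤ lam ^ 2 * ∑ k ∈ Finset.range (p + 1),
      (p.choose k : ℝ) * (α (k + 1) d * α (p - k) (d + 1)))
    {C : ℝ} (h1 : ∀ d, α 1 d ≤ C * gam ^ d) (h2 : ∀ d, α 2 d ≤ C * gam ^ (2 * d)) :
    ∃ A : ℝ, 0 < A ∧ ∀ p d, 1 ≤ p → α p d ≤ (A * p * gam ^ d) ^ p := by
  have hg0 : 0 < gam := by linarith
  have hl0 : 0 < lam := by linarith
  -- the normalization suited to exponential tails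
  set β : ℕ → ℕ → ℝ := fun p d => α p d / (p.factorial * gam ^ (p * d)) with hβ
  have hβ_nonneg : ∀ p d, 0 ≤ β p d := fun p d => by
    have := hα p d
    simp only [hβ]
    positivity
  have hβ_zero : ∀ d, β 0 d = 1 := fun d => by simp [hβ, h0]
  have hβrec : ∀ p d, β (p + 1) (d + 1) ≤ lam ^ 2 * ∑ k ∈ Finset.range (p + 1),
      ((k + 1 : ℕ) : ℝ) / ((p + 1 : ℕ) : ℝ) * (1 / gam ^ (k + 1)) *
        (β (k + 1) d * β (p - k) (d + 1)) := by
    intro p d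
    have hc : (0 : ℝ) < (p + 1).factorial * gam ^ ((p + 1) * (d + 1)) := by positivity
    simp only [hβ]
    rw [div_le_iff₀ hc]
    refine (hrec p d).trans (le_of_eq ?_)
    rw [mul_assoc, Finset.sum_mul]
    congr 1
    refine Finset.sum_congr rfl fun k hk => ?_
    obtain ⟨m, rfl⟩ : ∃ m, p = k + m := ⟨p - k, by have := Finset.mem_range.mp hk; omega⟩
    rw [show k + m - k = m by omega]
    have hch : ((k + m).choose k : ℝ) * (k.factorial * m.factorial) = (k + m).factorial := by
      rw [← mul_assoc, Nat.choose_symm_add]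
      exact_mod_cast Nat.add_choose_mul_factorial_mul_factorial k m
    have e1 : (((k + m + 1).factorial : ℕ) : ℝ)
        = ((k + m + 1 : ℕ) : ℝ) * (((k + m).choose k : ℝ) * (k.factorial * m.factorial)) := by
      rw [hch, Nat.factorial_succ]
      push_cast
      ring
    have e2 : (((k + 1).factorial : ℕ) : ℝ) = ((k + 1 : ℕ) : ℝ) * k.factorial := by
      rw [Nat.factorial_succ]
      push_cast
      ring
    have e3 : gam ^ ((k + m + 1) * (d + 1))
        = gam ^ (k + 1) * gam ^ ((k + 1) * d) * gam ^ (m * (d + 1)) := by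
      rw [← pow_add, ← pow_add]
      congr 1
      ring
    rw [e1, e2, e3]
    have hk1 : ((k + 1 : ℕ) : ℝ) ≠ 0 := by positivity
    have hk2 : ((k + m + 1 : ℕ) : ℝ) ≠ 0 := by positivity
    field_simp
  -- `b` is small enough to absorb the convolution terms: `κ + 4 * lam ^ 2 * b = 1`; then `A` is
  -- large enough for the first two rows and for the first column
  set κ := lam ^ 2 / gam ^ 3 with hκ
  have hκ1 : κ < 1 := (div_lt_one (by positivity)).mpr hlg
  have hκ0 : 0 < κ := by positivity
  set b := (1 - κ) / (4 * lam ^ 2) with hb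
  have hb0 : 0 < b := div_pos (by linarith) (by positivity)
  have hb1 : b ≤ 1 := by
    rw [hb, div_le_one (by positivity)]
    nlinarith
  set A := 4 * (|C| + 1) / b with hA
  have hA0 : 0 < A := by positivity
  have hbA : b * A = 4 * (|C| + 1) := by
    rw [hA]
    field_simp
  have hA4 : 4 ≤ A := by
    have : b * A ≤ 1 * A := by gcongr
    nlinarith [abs_nonneg C]
  have hCle := le_abs_self C
  have hβ1 : ∀ d, β 1 d ≤ |C| := fun d => by
    simp only [hβ]
    rw [div_le_iff₀ (by positivity)]
    have := h1 d
    simp only [Nat.factorial_one, Nat.cast_one, one_mul]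
    exact this.trans (by gcongr)
  have hβ2 : ∀ d, β 2 d ≤ |C| := fun d => by
    simp only [hβ]
    rw [div_le_iff₀ (by positivity)]
    have := h2 d
    have h3 : C * gam ^ (2 * d) ≤ |C| * gam ^ (2 * d) := by gcongr
    have h4 : 0 ≤ |C| * gam ^ (2 * d) := by positivity
    simp only [Nat.factorial_two, Nat.cast_two]
    linarith
  have main : ∀ d p, 1 ≤ p → β p d ≤ b * A ^ p / (p : ℝ) ^ 2 := by
    intro d
    induction d with
    | zero =>
      intro p hp
      have h3 : β p 0 ≤ 1 := by
        simp only [hβ, hp0, mul_zero, pow_zero, mul_one]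
        rw [div_le_one (by positivity)]
        exact_mod_cast Nat.one_le_iff_ne_zero.mpr (Nat.factorial_ne_zero p)
      refine h3.trans ?_
      rw [le_div_iff₀ (by positivity), one_mul]
      obtain ⟨q, rfl⟩ : ∃ q, p = q + 1 := ⟨p - 1, by omega⟩
      have h4 : (((q + 1 : ℕ) : ℝ)) ^ 2 ≤ 4 * 4 ^ q := by
        have h5 : q + 1 ≤ 2 ^ (q + 1) := Nat.lt_two_pow_self.le
        have h6 : (((q + 1 : ℕ) : ℝ)) ≤ 2 ^ (q + 1) := by exact_mod_cast h5
        calc (((q + 1 : ℕ) : ℝ)) ^ 2 ≤ (2 ^ (q + 1)) ^ 2 := by gcongr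
          _ = 4 * 4 ^ q := by
            rw [← pow_mul, mul_comm, pow_mul, pow_succ]
            norm_num
            ring
      refine h4.trans ?_
      rw [pow_succ', ← mul_assoc, hbA]
      gcongr
      linarith [abs_nonneg C]
    | succ d ihd =>
      intro p
      induction p using Nat.strong_induction_on with
      | _ p ihp =>
        intro hp
        rcases Nat.lt_or_ge p 3 with hp3 | hp3
        · interval_cases p
          · refine (hβ1 _).trans ?_
            rw [pow_one, hbA]
            norm_num
            linarith [abs_nonneg C]
          · refine (hβ2 _).trans ?_
            rw [sq, ← mul_assoc, hbA, le_div_iff₀ (by norm_num)]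
            norm_num
            nlinarith [abs_nonneg C]
        · obtain ⟨q, rfl⟩ : ∃ q, p = q + 1 := ⟨p - 1, by omega⟩
          have hq : (0 : ℝ) < ((q + 1 : ℕ) : ℝ) := by positivity
          have hlast : lam ^ 2 * (((q + 1 : ℕ) : ℝ) / ((q + 1 : ℕ) : ℝ) * (1 / gam ^ (q + 1)) *
              (β (q + 1) d * β (q - q) (d + 1)))
              ≤ κ * (b * A ^ (q + 1) / ((q + 1 : ℕ) : ℝ) ^ 2) := by
            rw [div_self hq.ne', one_mul, Nat.sub_self, hβ_zero, mul_one, ← mul_assoc, mul_one_div]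
            have hge : gam ^ 3 ≤ gam ^ (q + 1) := pow_le_pow_right₀ hgam hp3
            have := ihd (q + 1) (by omega)
            have := hβ_nonneg (q + 1) d
            rw [hκ]
            gcongr
          have hfirst : ∑ k ∈ Finset.range q,
              ((k + 1 : ℕ) : ℝ) / ((q + 1 : ℕ) : ℝ) * (1 / gam ^ (k + 1)) *
                (β (k + 1) d * β (q - k) (d + 1))
              ≤ b ^ 2 * A ^ (q + 1) * (4 / ((q + 1 : ℕ) : ℝ) ^ 2) := by
            refine le_trans ?_ (mul_le_mul_of_nonneg_left (sum_convolution_inv_sq_le q)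
              (by positivity))
            rw [Finset.mul_sum]
            refine Finset.sum_le_sum fun k hk => ?_
            have hk := Finset.mem_range.mp hk
            have i1 := ihd (k + 1) (by omega)
            have i2 := ihp (q - k) (by omega) (by omega)
            have i3 := hβ_nonneg (k + 1) d
            have i4 := hβ_nonneg (q - k) (d + 1)
            have i5 : 1 / gam ^ (k + 1) ≤ 1 :=
              (div_le_one (by positivity)).mpr (one_le_pow₀ hgam)
            calc ((k + 1 : ℕ) : ℝ) / ((q + 1 : ℕ) : ℝ) * (1 / gam ^ (k + 1)) *
                  (β (k + 1) d * β (q - k) (d + 1))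
                ≤ ((k + 1 : ℕ) : ℝ) / ((q + 1 : ℕ) : ℝ) * 1 *
                  ((b * A ^ (k + 1) / ((k + 1 : ℕ) : ℝ) ^ 2)
                    * (b * A ^ (q - k) / ((q - k : ℕ) : ℝ) ^ 2)) := by gcongr
              _ = _ := by
                rw [show A ^ (q + 1) = A ^ (k + 1) * A ^ (q - k) by
                  rw [← pow_add]
                  congr 1
                  omega]
                ring
          have h := hβrec q d
          rw [Finset.sum_range_succ, mul_add] at h
          have h3 : lam ^ 2 * (b ^ 2 * A ^ (q + 1) * (4 / ((q + 1 : ℕ) : ℝ) ^ 2))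
              = (1 - κ) * (b * A ^ (q + 1) / ((q + 1 : ℕ) : ℝ) ^ 2) := by
            have : 1 - κ = b * (4 * lam ^ 2) := by
              rw [hb]
              field_simp
            rw [this]
            ring
          have h4 := mul_le_mul_of_nonneg_left hfirst (by positivity : 0 ≤ lam ^ 2)
          linarith
  refine ⟨A, hA0, fun p d hp => ?_⟩
  have h := main d p hp
  simp only [hβ] at h
  rw [div_le_iff₀ (by positivity)] at h
  have hp1 : (1 : ℝ) ≤ (p : ℝ) ^ 2 := one_le_pow₀ (by exact_mod_cast hp)
  have hfac : (p.factorial : ℝ) ≤ (p : ℝ) ^ p := by exact_mod_cast Nat.factorial_le_pow p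
  calc α p d ≤ _ := h
    _ ≤ 1 * A ^ p / 1 * ((p : ℝ) ^ p * gam ^ (p * d)) := by gcongr
    _ = _ := by
      rw [mul_pow, mul_pow, ← pow_mul, mul_comm d p]
      ring

/-! ### Survival probabilities -/

/-- The inequality `1 - exp (-y) ≤ y / (1 + y / 2)`. -/
theorem one_sub_exp_neg_le {y : ℝ} (hy : 0 ≤ y) : (1 - Real.exp (-y)) * (2 + y) ≤ 2 * y := by
  have hmono : MonotoneOn (fun y : ℝ => (2 + y) * Real.exp (-y) + y) (Set.Ici 0) := by
    have hd : ∀ y : ℝ, HasDerivAt (fun y : ℝ => (2 + y) * Real.exp (-y) + y)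
        (1 * Real.exp (-y) + (2 + y) * (Real.exp (-y) * -1) + 1) y := fun y =>
      (((hasDerivAt_id y).const_add 2).mul ((hasDerivAt_neg y).exp)).add (hasDerivAt_id y)
    refine monotoneOn_of_deriv_nonneg (convex_Ici 0)
      (fun y _ => (hd y).continuousAt.continuousWithinAt)
      (fun y _ => (hd y).differentiableAt.differentiableWithinAt) fun y _ => ?_
    rw [(hd y).deriv]
    have h1 := Real.add_one_le_exp y
    have h2 : Real.exp (-y) * Real.exp y = 1 := by rw [← Real.exp_add]; simp
    have h3 := Real.exp_pos (-y)
    nlinarith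
  have h := hmono (Set.mem_Ici.mpr le_rfl) (Set.mem_Ici.mpr hy) hy
  simp only [neg_zero, Real.exp_zero] at h
  linarith

/-- The survival probability of a slightly supercritical tree is eventually at most three times
the excess of the mean offspring over `1`. -/
theorem eventually_survival_le {lam : ℝ} (hlam : 1 < lam) {q : ℕ → ℝ} (hq0 : q 0 = 1)
    (hq : ∀ d, q (d + 1) = 1 - Real.exp (-(lam * q d))) :
    ∃ d₁, ∀ d ≥ d₁, q d ≤ 3 * (lam - 1) := by
  have hl0 : 0 < lam := by linarith
  have hpos : ∀ d, 0 < q d := by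
    intro d
    induction d with
    | zero => rw [hq0]; norm_num
    | succ d ih =>
      rw [hq, sub_pos, Real.exp_lt_one_iff]
      have := mul_pos hl0 ih
      linarith
  -- in terms of `1 / q`, the recursion is bounded by an affine one, with fixed point
  -- `lam / (2 * (lam - 1))`
  have hinv : ∀ d, 1 / (lam * q d) + 1 / 2 ≤ 1 / q (d + 1) := by
    intro d
    have h1 := one_sub_exp_neg_le (mul_pos hl0 (hpos d)).le
    rw [← hq] at h1
    have h2 := hpos (d + 1)
    have h3 := mul_pos hl0 (hpos d)
    generalize lam * q d = y at *
    rw [div_add_div _ _ h3.ne' two_ne_zero, div_le_div_iff₀ (by positivity) h2]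
    linarith
  have hlow : ∀ d, lam / (2 * (lam - 1)) * (1 - (1 / lam) ^ d) ≤ 1 / q d := by
    intro d
    induction d with
    | zero => simp [hq0]
    | succ d ih =>
      refine le_trans ?_ (hinv d)
      have h1 : 1 / lam * (lam / (2 * (lam - 1)) * (1 - (1 / lam) ^ d)) ≤ 1 / lam * (1 / q d) := by
        gcongr
      have h2 : 1 / (lam * q d) = 1 / lam * (1 / q d) := by
        have := (hpos d).ne'
        field_simp
      have h3 : lam - 1 ≠ 0 := by linarith
      have h4 : lam / (2 * (lam - 1)) * (1 - (1 / lam) ^ (d + 1))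
          = 1 / lam * (lam / (2 * (lam - 1)) * (1 - (1 / lam) ^ d)) + 1 / 2 := by
        rw [pow_succ]
        generalize (1 / lam) ^ d = z
        field_simp
        ring
      linarith
  have hlim : Filter.Tendsto (fun d => (1 / lam) ^ d) Filter.atTop (nhds 0) :=
    tendsto_pow_atTop_nhds_zero_of_lt_one (by positivity) ((div_lt_one hl0).mpr hlam)
  obtain ⟨d₁, hd₁⟩ := Filter.eventually_atTop.mp (hlim.eventually (ge_mem_nhds
    (show (0 : ℝ) < 1 / 3 by norm_num)))
  refine ⟨d₁, fun d hd => ?_⟩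
  have h1 := hd₁ d hd
  have h2 := hlow d
  have h5 : 0 < lam - 1 := by linarith
  have h3 : lam / (2 * (lam - 1)) * (1 - 1 / 3) ≤ lam / (2 * (lam - 1)) * (1 - (1 / lam) ^ d) := by
    gcongr
  have h4 := h3.trans h2
  have h6 : lam / (2 * (lam - 1)) * (1 - 1 / 3) = lam / (3 * (lam - 1)) := by
    field_simp
    norm_num
  rw [h6, div_le_div_iff₀ (by positivity) (hpos d)] at h4
  nlinarith [hpos d]

/-! ### Growth rate for independent trees -/

theorem moment_succ_le_real (a : ℝ≥0) (p d : ℕ) :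
    (moment a (p + 1) (d + 1)).toReal ≤ (a : ℝ) ^ 2 * ∑ k ∈ Finset.range (p + 1),
      (p.choose k : ℝ) * ((moment a (k + 1) d).toReal * (moment a (p - k) (d + 1)).toReal) := by
  have htop : ∀ k ∈ Finset.range (p + 1),
      (p.choose k : ℝ≥0∞) * (moment a (k + 1) d * moment a (p - k) (d + 1)) ≠ ⊤ := fun k _ =>
    ENNReal.mul_ne_top (by simp) (ENNReal.mul_ne_top (moment_ne_top _ _ _) (moment_ne_top _ _ _))
  have h := ENNReal.toReal_mono
    (ENNReal.mul_ne_top (by simp) (ENNReal.sum_ne_top.mpr htop)) (moment_succ_le a p d)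
  rw [ENNReal.toReal_mul, ENNReal.toReal_sum htop] at h
  simpa [ENNReal.toReal_mul] using h

theorem three_mul_moment_two_mul_moment_one_le_real (a : ℝ≥0) (d e : ℕ) :
    3 * ((moment a 2 d).toReal * (moment a 1 e).toReal) ≤
      2 * ((moment a 3 d).toReal * (1 - (extinctProb a e).toReal) ^ 2)
        + (moment a 3 e).toReal * (1 - (extinctProb a d).toReal) ^ 2 := by
  have hs : ∀ d, ((1 : ℝ≥0∞) - extinctProb a d).toReal = 1 - (extinctProb a d).toReal := fun d => by
    rw [ENNReal.toReal_sub_of_le (extinctProb_le_one a d) ENNReal.one_ne_top, ENNReal.toReal_one]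
  have hst : ∀ d, ((1 : ℝ≥0∞) - extinctProb a d) ^ 2 ≠ ⊤ := fun d =>
    ENNReal.pow_ne_top (ne_top_of_le_ne_top ENNReal.one_ne_top tsub_le_self)
  have t1 : 2 * (moment a 3 d * (1 - extinctProb a e) ^ 2) ≠ ⊤ :=
    ENNReal.mul_ne_top (by simp) (ENNReal.mul_ne_top (moment_ne_top _ _ _) (hst _))
  have t2 : moment a 3 e * (1 - extinctProb a d) ^ 2 ≠ ⊤ :=
    ENNReal.mul_ne_top (moment_ne_top _ _ _) (hst _)
  have h := ENNReal.toReal_mono (ENNReal.add_ne_top.mpr ⟨t1, t2⟩)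
    (three_mul_moment_two_mul_moment_one_le a d e)
  rw [ENNReal.toReal_add t1 t2] at h
  simpa [ENNReal.toReal_mul, hs] using h

/-- The lower moments of a nonnegative variable are controlled by the third one. -/
theorem moment_le_of_third (a : ℝ≥0) (d p : ℕ) (hp : p ≤ 3) {g : ℝ} (hg : 0 < g) :
    (moment a p d).toReal ≤ g ^ p + g ^ p / g ^ 3 * (moment a 3 d).toReal := by
  have hkey : ∀ w : ℝ≥0∞,
      w ^ p ≤ ENNReal.ofReal (g ^ p) + ENNReal.ofReal (g ^ p / g ^ 3) * w ^ 3 := by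
    intro w
    rcases eq_or_ne w ⊤ with rfl | hw
    · have : ENNReal.ofReal (g ^ p / g ^ 3) * ⊤ ^ 3 = ⊤ := by
        rw [ENNReal.top_pow (by norm_num),
          ENNReal.mul_top (ENNReal.ofReal_pos.mpr (by positivity)).ne']
      rw [this, add_top]
      exact le_top
    lift w to ℝ≥0 using hw
    rw [← ENNReal.ofReal_coe_nnreal, ← ENNReal.ofReal_pow (by positivity),
      ← ENNReal.ofReal_pow (by positivity), ← ENNReal.ofReal_mul (by positivity),
      ← ENNReal.ofReal_add (by positivity) (by positivity)]
    refine ENNReal.ofReal_le_ofReal ?_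
    have hw := w.coe_nonneg
    generalize (w : ℝ) = x at *
    have h1 : g ^ p / g ^ 3 * x ^ 3 = g ^ p * (x / g) ^ 3 := by
      rw [div_pow]
      ring
    have h2 : x ^ p = g ^ p * (x / g) ^ p := by
      rw [div_pow]
      field_simp
    have h3 : (x / g) ^ p ≤ 1 + (x / g) ^ 3 := by
      have hx : 0 ≤ x / g := by positivity
      generalize x / g = y at *
      rcases le_total y 1 with hy | hy
      · have := pow_le_one₀ hx hy (n := p)
        have : 0 ≤ y ^ 3 := by positivity
        linarith
      · have := pow_le_pow_right₀ hy hp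
        linarith
    rw [h1, h2]
    have := mul_le_mul_of_nonneg_left h3 (by positivity : 0 ≤ g ^ p)
    linarith
  have h := expect_mono (gwLaw a d) fun t => expect_mono (gwLaw a d) fun t' => hkey (weight d t t')
  simp only [expect_add, expect_const_mul, expect_const] at h
  have h' : moment a p d
      ≤ ENNReal.ofReal (g ^ p) + ENNReal.ofReal (g ^ p / g ^ 3) * moment a 3 d := h
  have t : ENNReal.ofReal (g ^ p / g ^ 3) * moment a 3 d ≠ ⊤ :=
    ENNReal.mul_ne_top (by simp) (moment_ne_top _ _ _)
  have h2 := ENNReal.toReal_mono (ENNReal.add_ne_top.mpr ⟨by simp, t⟩) h'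
  rw [ENNReal.toReal_add (by simp) t, ENNReal.toReal_mul, ENNReal.toReal_ofReal (by positivity),
    ENNReal.toReal_ofReal (by positivity)] at h2
  exact h2

/-- One step of the recursion for the third moment `y` in terms of the previous one `x`: the terms
in `ε ^ 2` are absorbed in the gap between `lam ^ 2` and the cube of the rate. -/
theorem third_moment_step {ε x y : ℝ} (hε0 : 0 ≤ ε) (hε1 : ε ≤ 1 / 200) (hx : 0 ≤ x) (hy : 0 ≤ y)
    (h : y ≤ (1 + ε) ^ 2 * (x + 15 * ε ^ 2 * x + 12 * ε ^ 2 * y)) :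
    y ≤ (1 + 9 / 4 * ε) * x := by
  have e2 : ε ^ 2 ≤ ε / 200 := by nlinarith
  have e3 : ε ^ 3 ≤ ε ^ 2 := by
    have := mul_le_mul_of_nonneg_right hε1 (sq_nonneg ε)
    nlinarith [sq_nonneg ε]
  have e4 : ε ^ 4 ≤ ε ^ 3 := by
    have : 0 ≤ ε ^ 3 := by positivity
    nlinarith
  have e3' : ε ^ 3 ≤ ε ^ 2 / 200 := by nlinarith [sq_nonneg ε]
  have c1 : (1 + ε) ^ 2 * (1 + 15 * ε ^ 2) ≤ 1 + 2 * ε + 17 * ε ^ 2 := by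
    have : (1 + ε) ^ 2 * (1 + 15 * ε ^ 2)
        = 1 + 2 * ε + 16 * ε ^ 2 + 30 * ε ^ 3 + 15 * ε ^ 4 := by ring
    linarith
  have c2 : (1 + ε) ^ 2 * (12 * ε ^ 2) ≤ 14 * ε ^ 2 := by
    have : (1 + ε) ^ 2 * (12 * ε ^ 2) = 12 * ε ^ 2 + 24 * ε ^ 3 + 12 * ε ^ 4 := by ring
    linarith
  have c4 : 1 + 2 * ε + 17 * ε ^ 2 ≤ (1 - 14 * ε ^ 2) * (1 + 9 / 4 * ε) := by
    have : (1 - 14 * ε ^ 2) * (1 + 9 / 4 * ε) = 1 + 9 / 4 * ε - 14 * ε ^ 2 - 63 / 2 * ε ^ 3 := by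
      ring
    linarith
  have c6 : 0 < 1 - 14 * ε ^ 2 := by linarith
  have i1 := mul_le_mul_of_nonneg_right c1 hx
  have i2 := mul_le_mul_of_nonneg_right c2 hy
  have i3 := mul_le_mul_of_nonneg_right c4 hx
  refine le_of_mul_le_mul_left (a := 1 - 14 * ε ^ 2) ?_ c6
  linarith

/-- For slightly supercritical trees, all moments of the matching weight of independent trees grow
at a rate smaller than that of the trees. -/
theorem exists_moment_le {lam : ℝ} (h1 : 1 < lam) (h2 : lam ≤ 1 + 1 / 200) :
    ∃ A : ℝ, 0 < A ∧ ∀ p d, 1 ≤ p →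
      moment lam.toNNReal p d ≤ ENNReal.ofReal ((A * p * (1 + 3 / 4 * (lam - 1)) ^ d) ^ p) := by
  set a := lam.toNNReal with ha
  have hacoe : (a : ℝ) = lam := Real.coe_toNNReal _ (by linarith)
  set gam := 1 + 3 / 4 * (lam - 1) with hgam
  obtain ⟨ε, hε⟩ : ∃ ε, ε = lam - 1 := ⟨_, rfl⟩
  have hlam : lam = 1 + ε := by linarith
  have hε0 : 0 < ε := by linarith
  have hε1 : ε ≤ 1 / 200 := by linarith
  have hg1 : 1 ≤ gam := by linarith
  have hg0 : 0 < gam := by linarith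
  set q : ℕ → ℝ := fun d => 1 - (extinctProb a d).toReal with hq
  have hq_nonneg : ∀ d, 0 ≤ q d := fun d => by
    have := ENNReal.toReal_mono ENNReal.one_ne_top (extinctProb_le_one a d)
    rw [ENNReal.toReal_one] at this
    simp only [hq]
    linarith
  obtain ⟨d₁, hd₁⟩ := eventually_survival_le h1 (q := q)
    (by simp [hq, extinctProb, gwLaw, dead])
    (fun d => by
      simp only [hq]
      rw [extinctProb_succ, ENNReal.toReal_ofReal (Real.exp_pos _).le, hacoe]
      congr 2
      ring)
  rw [← hε] at hd₁
  set α : ℕ → ℕ → ℝ := fun p d => (moment a p d).toReal with hα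
  have hα0 : ∀ p d, 0 ≤ α p d := fun p d => ENNReal.toReal_nonneg
  have hrec : ∀ p d, α (p + 1) (d + 1) ≤ lam ^ 2 * ∑ k ∈ Finset.range (p + 1),
      (p.choose k : ℝ) * (α (k + 1) d * α (p - k) (d + 1)) := fun p d => by
    rw [← hacoe]
    exact moment_succ_le_real a p d
  have hstep : ∀ d ≥ d₁, α 3 (d + 1) ≤ gam ^ 3 * α 3 d := by
    intro d hd
    have r := hrec 2 d
    have e0 : α 0 (d + 1) = 1 := by simp [hα, moment_zero_left]
    simp only [Finset.sum_range_succ, Finset.sum_range_zero, Nat.choose_zero_right,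
      Nat.choose_succ_self_right, Nat.choose_self, zero_add, Nat.sub_zero, Nat.sub_self,
      Nat.reduceAdd, Nat.reduceSub, e0, Nat.cast_one, Nat.cast_ofNat, one_mul, mul_one] at r
    have hQ : ∀ e ≥ d₁, q e ^ 2 ≤ 9 * ε ^ 2 := fun e he => by
      have := pow_le_pow_left₀ (hq_nonneg e) (hd₁ e he) 2
      linarith
    have m1 : 3 * (α 2 d * α 1 (d + 1)) ≤ 2 * (α 3 d * q (d + 1) ^ 2) + α 3 (d + 1) * q d ^ 2 :=
      three_mul_moment_two_mul_moment_one_le_real a d (d + 1)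
    have m2 : 3 * (α 2 (d + 1) * α 1 d) ≤ 2 * (α 3 (d + 1) * q d ^ 2) + α 3 d * q (d + 1) ^ 2 :=
      three_mul_moment_two_mul_moment_one_le_real a (d + 1) d
    have b1 := mul_le_mul_of_nonneg_left (hQ d hd) (hα0 3 (d + 1))
    have b2 := mul_le_mul_of_nonneg_left (hQ (d + 1) (by omega)) (hα0 3 d)
    have x0 := hα0 3 d
    have y0 := hα0 3 (d + 1)
    generalize α 3 d = x at *
    generalize α 3 (d + 1) = y at *
    have s : y ≤ (1 + ε) ^ 2 * (x + 15 * ε ^ 2 * x + 12 * ε ^ 2 * y) := by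
      rw [← hlam]
      refine r.trans (mul_le_mul_of_nonneg_left ?_ (by positivity))
      linarith
    have g3 : 1 + 9 / 4 * ε ≤ gam ^ 3 := by
      have := one_add_mul_le_pow (a := 3 / 4 * ε) (by linarith) 3
      rw [hgam, ← hε]
      push_cast at this
      linarith
    exact (third_moment_step hε0.le hε1 x0 y0 s).trans (mul_le_mul_of_nonneg_right g3 x0)
  -- the first `d₁` values are absorbed in the constant
  obtain ⟨C, hC0, hC⟩ : ∃ C, 0 ≤ C ∧ ∀ d, α 3 d ≤ C * (gam ^ d) ^ 3 := by
    refine ⟨∑ e ∈ Finset.range (d₁ + 1), α 3 e, Finset.sum_nonneg fun e _ => hα0 3 e, ?_⟩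
    set C := ∑ e ∈ Finset.range (d₁ + 1), α 3 e with hCdef
    have hC0 : 0 ≤ C := Finset.sum_nonneg fun e _ => hα0 3 e
    have hsmall : ∀ d ≤ d₁, α 3 d ≤ C * (gam ^ d) ^ 3 := by
      intro d hd
      have : α 3 d ≤ C := Finset.single_le_sum (f := fun e => α 3 e) (fun e _ => hα0 3 e)
        (Finset.mem_range.mpr (by omega))
      refine this.trans (le_mul_of_one_le_right hC0 ?_)
      exact one_le_pow₀ (one_le_pow₀ hg1)
    intro d
    induction d with
    | zero => exact hsmall 0 (Nat.zero_le _)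
    | succ d ih =>
      rcases Nat.lt_or_ge d d₁ with hd | hd
      · exact hsmall (d + 1) hd
      · refine (hstep d hd).trans ?_
        calc gam ^ 3 * α 3 d ≤ gam ^ 3 * (C * (gam ^ d) ^ 3) := by gcongr
          _ = C * (gam ^ (d + 1)) ^ 3 := by ring
  have hlow : ∀ p ≤ 3, ∀ d, α p d ≤ (1 + C) * gam ^ (p * d) := by
    intro p hp d
    have hgd : 0 < gam ^ d := by positivity
    have h := moment_le_of_third a d p hp hgd
    have h3 : (gam ^ d) ^ p / (gam ^ d) ^ 3 * α 3 d
        ≤ (gam ^ d) ^ p / (gam ^ d) ^ 3 * (C * (gam ^ d) ^ 3) := by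
      gcongr
      exact hC d
    have h4 : (gam ^ d) ^ p / (gam ^ d) ^ 3 * (C * (gam ^ d) ^ 3) = C * (gam ^ d) ^ p := by
      field_simp
    have h5 : (gam ^ d) ^ p = gam ^ (p * d) := by rw [← pow_mul, mul_comm]
    rw [h4] at h3
    rw [← h5]
    have : α p d ≤ (gam ^ d) ^ p + (gam ^ d) ^ p / (gam ^ d) ^ 3 * α 3 d := h
    linarith
  obtain ⟨A, hA, hmain⟩ := exists_forall_le_of_recursive hg1 h1.le
    (by
      have := one_add_mul_le_pow (a := 3 / 4 * ε) (by linarith) 3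
      rw [hgam, ← hε, hlam]
      push_cast at this
      nlinarith)
    hα0 (fun d => by simp [hα, moment_zero_left]) (fun p => by simp [hα, moment_zero_right]) hrec
    (C := 1 + C) (fun d => by simpa using hlow 1 (by norm_num) d) (hlow 2 (by norm_num))
  refine ⟨A, hA, fun p d hp => ?_⟩
  rw [← ENNReal.ofReal_toReal (moment_ne_top a p d)]
  exact ENNReal.ofReal_le_ofReal (hmain p d hp)

section

/-! ### Laws of the intersecting trees -/

/-- The trees truncated at depth `d` in which the children of each vertex are sorted by kind: such
a tree encodes both the first and the second tree above a vertex. -/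
abbrev ColTree : ℕ → Type
  | 0 => Unit
  | d + 1 => Kind → List (ColTree d)

/-- The family indexed by kinds with given members. -/
def kindFun {α : Type*} (x y z : α) : Kind → α
  | Kind.common => x
  | Kind.first => y
  | Kind.second => z

/-- The law of the coloured tree above a vertex of kind `κ`, where `m κ κ'` is the mean number of
children of kind `κ'`. -/
def colLaw (m : Kind → Kind → ℝ≥0) : (d : ℕ) → Kind → PMF (ColTree d)
  | 0, _ => PMF.pure ()
  | d + 1, κ =>
    (poissonList (m κ Kind.common) (colLaw m d Kind.common)).bind fun C =>
      (poissonList (m κ Kind.first) (colLaw m d Kind.first)).bind fun F =>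
        (poissonList (m κ Kind.second) (colLaw m d Kind.second)).map fun S => kindFun C F S

theorem expect_colLaw_succ (m : Kind → Kind → ℝ≥0) (d : ℕ) (κ : Kind)
    (f : ColTree (d + 1) → ℝ≥0∞) :
    expect (colLaw m (d + 1) κ) f =
      expect (poissonList (m κ Kind.common) (colLaw m d Kind.common)) fun C =>
        expect (poissonList (m κ Kind.first) (colLaw m d Kind.first)) fun F =>
          expect (poissonList (m κ Kind.second) (colLaw m d Kind.second)) fun S =>
            f (kindFun C F S) := by
  simp only [colLaw, expect_bind, expect_map]

/-- The tree truncated at depth `b` made of the vertices of kinds `common` and `κ` of a coloured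
tree. -/
def proj (κ : Kind) : (b D : ℕ) → ColTree D → TruncTree b
  | 0, _, _ => ()
  | _ + 1, 0, _ => (0 : Multiset _)
  | b + 1, D + 1, c => (Multiset.map (proj κ b D) (c Kind.common : Multiset (ColTree D)))
      + Multiset.map (proj κ b D) (c κ : Multiset (ColTree D))

/-- The vertices of kind `common` or `κ` have `a` children of these kinds in the mean. -/
structure Balanced (m : Kind → Kind → ℝ≥0) (a : ℝ≥0) (κ : Kind) : Prop where
  of_common : m Kind.common Kind.common + m Kind.common κ = a
  of_self : m κ Kind.common + m κ κ = a

variable {m : Kind → Kind → ℝ≥0} {a : ℝ≥0}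

/-- The children of two kinds of a vertex, whose subtrees are Galton-Watson trees, form together
the children of the root of a Galton-Watson tree. -/
theorem expect_superposition {α : Type*} {b : ℕ} {p q : PMF α} {φ : α → TruncTree b}
    (hp : p.map φ = gwLaw a b) (hq : q.map φ = gwLaw a b) {a₁ a₂ : ℝ≥0} (ha : a₁ + a₂ = a)
    (f : Multiset (TruncTree b) → ℝ≥0∞) :
    expect (poissonList a₁ p) (fun C => expect (poissonList a₂ q) (fun F =>
        f (Multiset.map φ (C : Multiset α) + Multiset.map φ (F : Multiset α))))
      = expect (gwLaw a (b + 1)) f := by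
  simp only [Multiset.map_coe, Multiset.coe_add]
  rw [expect_poissonList_map a₁ p φ (fun l => expect (poissonList a₂ q) (fun F =>
    f ((l ++ F.map φ : List (TruncTree b)) : Multiset (TruncTree b)))), hp]
  have h : ∀ l : List (TruncTree b), expect (poissonList a₂ q) (fun F =>
      f ((l ++ F.map φ : List (TruncTree b)) : Multiset (TruncTree b)))
      = expect (poissonList a₂ (gwLaw a b)) (fun l' =>
        f ((l ++ l' : List (TruncTree b)) : Multiset (TruncTree b))) := by
    intro l
    rw [← hq, ← expect_poissonList_map]
  simp only [h]
  rw [expect_poissonList_append a₁ a₂ _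
    (fun l : List (TruncTree b) => f (l : Multiset (TruncTree b))), ha, expect_gwLaw_succ]

/-- The children of the third kind are irrelevant to a function of the children of two kinds. -/
theorem expect_colLaw_two {d : ℕ} {κ κ₀ : Kind} (hκ : κ ≠ Kind.common)
    (f : List (ColTree d) → List (ColTree d) → ℝ≥0∞) :
    expect (colLaw m (d + 1) κ₀) (fun c => f (c Kind.common) (c κ)) =
      expect (poissonList (m κ₀ Kind.common) (colLaw m d Kind.common)) fun C =>
        expect (poissonList (m κ₀ κ) (colLaw m d κ)) fun K => f C K := by
  rw [expect_colLaw_succ]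
  cases κ
  · exact absurd rfl hκ
  · simp only [kindFun, expect_const]
  · simp only [kindFun, expect_const]

/-- Each of the two trees encoded by a coloured tree is a Galton-Watson tree, when the root belongs
to it. -/
theorem colLaw_map_proj {κ : Kind} (hκ : κ ≠ Kind.common) (hm : Balanced m a κ) {b D : ℕ}
    (hb : b ≤ D) {κ₀ : Kind} (hκ₀ : κ₀ = Kind.common ∨ κ₀ = κ) :
    (colLaw m D κ₀).map (proj κ b D) = gwLaw a b := by
  induction D generalizing b κ₀ with
  | zero =>
    obtain rfl : b = 0 := by omega
    refine expect_eq_of_forall fun f => ?_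
    simp [expect_map, gwLaw, proj]
  | succ D ih =>
    cases b with
    | zero =>
      refine expect_eq_of_forall fun f => ?_
      simp [expect_map, gwLaw, proj]
    | succ b =>
      refine expect_eq_of_forall fun f => ?_
      rw [expect_map]
      simp only [proj]
      rw [expect_colLaw_two hκ (fun C K : List (ColTree D) => f
        ((Multiset.map (proj κ b D) (C : Multiset (ColTree D)))
        + Multiset.map (proj κ b D) (K : Multiset (ColTree D))))]
      refine expect_superposition (ih (by omega) (Or.inl rfl)) (ih (by omega) (Or.inr rfl)) ?_ f
      rcases hκ₀ with rfl | rfl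
      · exact hm.of_common
      · exact hm.of_self

/-- The joint law of the first tree truncated at depth `b` and of the second tree truncated at
depth `c`, when the first tree is rooted at distance `j` above the root of the second one. -/
def spineLaw (m : Kind → Kind → ℝ≥0) (a : ℝ≥0) :
    (j b c : ℕ) → PMF (TruncTree b × TruncTree c)
  | 0, b, c => (colLaw m c Kind.common).map fun t =>
      (proj Kind.first b c t, proj Kind.second c c t)
  | _ + 1, 0, c => (gwLaw a c).map fun t => ((), t)
  | j + 1, b + 1, c => (gwLaw a (b + 1)).bind fun L =>
      (spineLaw m a j b c).map fun e => ((e.1 ::ₘ L : Multiset (TruncTree b)), e.2)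

/-- The law of the first tree alone in `spineLaw`, where the root of the second tree is an ordinary
vertex. -/
def pathLaw (a : ℝ≥0) : (j b : ℕ) → PMF (TruncTree b)
  | 0, b => gwLaw a b
  | _ + 1, 0 => PMF.pure ()
  | j + 1, b + 1 => (gwLaw a (b + 1)).bind fun L =>
      (pathLaw a j b).map fun t => (t ::ₘ L : Multiset (TruncTree b))

theorem expect_spineLaw_succ_succ (j b c : ℕ)
    (f : Multiset (TruncTree b) × TruncTree c → ℝ≥0∞) :
    expect (spineLaw m a (j + 1) (b + 1) c) f
      = expect (gwLaw a (b + 1)) fun L : Multiset (TruncTree b) =>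
          expect (spineLaw m a j b c) fun e => f (e.1 ::ₘ L, e.2) := by
  rw [spineLaw, expect_bind]
  simp only [expect_map]

/-- The second tree is a Galton-Watson tree. -/
theorem expect_spineLaw_snd (hm : Balanced m a Kind.second) (j b c : ℕ)
    (f : TruncTree c → ℝ≥0∞) :
    expect (spineLaw m a j b c) (fun e => f e.2) = expect (gwLaw a c) f := by
  induction j generalizing b with
  | zero =>
    rw [spineLaw, expect_map]
    simp only
    rw [← colLaw_map_proj (by simp) hm le_rfl (Or.inl rfl), expect_map]
  | succ j ih =>
    cases b with
    | zero => rw [spineLaw, expect_map]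
    | succ b =>
      rw [expect_spineLaw_succ_succ]
      simp only [ih, expect_const]

theorem expect_poissonList_sum {α : Type*} (r : ℝ≥0) (p : PMF α) (g : α → ℝ≥0∞) :
    expect (poissonList r p) (fun l => (Multiset.map g (l : Multiset α)).sum)
      = r * expect p g := by
  have h := expect_poissonList_pickSum r p (fun x _ => g x)
  simp only [expect_const] at h
  rw [← h]
  congr 1
  funext l
  exact (pickSum_coe l (fun x _ => g x)).symm

/-- The Mecke formula for the children of the root of the second tree. Seen from a common child of
this root, the pair of trees has the same law, with the path longer by one; seen from a child that
is only in the second tree, the two trees are independent. -/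
theorem expect_spineLaw_sum (hm₁ : Balanced m a Kind.first) (hm₂ : Balanced m a Kind.second)
    (j : ℕ) {b c : ℕ} (hb : b ≤ c) (g : TruncTree b → TruncTree c → ℝ≥0∞) :
    expect (spineLaw m a j b (c + 1)) (fun e : TruncTree b × Multiset (TruncTree c) =>
        (e.2.map (g e.1)).sum)
      = m Kind.common Kind.common * expect (spineLaw m a (j + 1) b c) (fun e => g e.1 e.2)
        + m Kind.common Kind.second *
          expect (pathLaw a j b) (fun t => expect (gwLaw a c) (g t)) := by
  have hunit : ∀ j (g : TruncTree 0 → TruncTree c → ℝ≥0∞),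
      expect (spineLaw m a j 0 (c + 1)) (fun e : TruncTree 0 × Multiset (TruncTree c) =>
        (e.2.map (g e.1)).sum)
      = m Kind.common Kind.common * expect (spineLaw m a (j + 1) 0 c) (fun e => g e.1 e.2)
        + m Kind.common Kind.second *
          expect (pathLaw a j 0) (fun t => expect (gwLaw a c) (g t)) := by
    intro j g
    have h1 := expect_spineLaw_snd hm₂ j 0 (c + 1)
      (fun M : Multiset (TruncTree c) => (M.map (g ())).sum)
    refine h1.trans ?_
    rw [expect_gwLaw_succ_sum, spineLaw, expect_map]
    have h2 : expect (pathLaw a j 0) (fun t => expect (gwLaw a c) (g t))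
        = expect (gwLaw a c) (g ()) :=
      expect_const (pathLaw a j 0) (expect (gwLaw a c) (g ()))
    rw [h2, ← add_mul, ← ENNReal.coe_add, hm₂.of_common]
  induction j generalizing b with
  | zero =>
    cases b with
    | zero => exact hunit 0 g
    | succ b =>
      have hlaw : ∀ {κ₀ : Kind}, κ₀ = Kind.common ∨ κ₀ = Kind.first →
          (colLaw m c κ₀).map (proj Kind.first b c) = gwLaw a b := fun h =>
        colLaw_map_proj (by simp) hm₁ (by omega) h
      have hsup := fun f => expect_superposition (hlaw (Or.inl rfl)) (hlaw (Or.inr rfl))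
        hm₁.of_common f
      rw [spineLaw, expect_map, expect_colLaw_succ]
      simp only [proj, kindFun, Multiset.map_add, Multiset.sum_add, expect_add, Multiset.map_map,
        expect_const]
      congr 1
      · have hpick : ∀ C F : List (ColTree c),
            (Multiset.map (g (Multiset.map (proj Kind.first b c) (C : Multiset (ColTree c))
              + Multiset.map (proj Kind.first b c) (F : Multiset (ColTree c)))
                ∘ proj Kind.second c c) (C : Multiset (ColTree c))).sum
            = pickSum C (fun u l => g (proj Kind.first b c u ::ₘ
                (Multiset.map (proj Kind.first b c) (l : Multiset (ColTree c))
                  + Multiset.map (proj Kind.first b c) (F : Multiset (ColTree c))))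
                (proj Kind.second c c u)) := by
          classical
          intro C F
          rw [pickSum_coe C (fun u M => g (proj Kind.first b c u ::ₘ
                (Multiset.map (proj Kind.first b c) M
                  + Multiset.map (proj Kind.first b c) (F : Multiset (ColTree c))))
                (proj Kind.second c c u))]
          refine congrArg Multiset.sum (Multiset.map_congr rfl fun u hu => ?_)
          rw [← Multiset.cons_add, ← Multiset.map_cons, Multiset.cons_erase hu]
          rfl
        simp only [hpick]
        rw [expect_comm]
        simp only [expect_poissonList_pickSum, expect_const_mul]
        rw [expect_comm, expect_spineLaw_succ_succ]
        congr 1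
        simp only [spineLaw, expect_map]
        rw [expect_comm (gwLaw a (b + 1))]
        congr 1
        funext u
        rw [expect_comm]
        exact hsup (fun L => g (proj Kind.first b c u ::ₘ L) (proj Kind.second c c u))
      · simp only [expect_poissonList_sum, expect_const_mul]
        congr 1
        have h3 : ∀ t : TruncTree (b + 1), expect (colLaw m c Kind.second)
            (g t ∘ proj Kind.second c c) = expect (gwLaw a c) (g t) := by
          intro t
          rw [← colLaw_map_proj (by simp) hm₂ le_rfl (Or.inr rfl), expect_map]
          rfl
        simp only [h3]
        exact hsup (fun L => expect (gwLaw a c) (g L))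
  | succ j ih =>
    cases b with
    | zero => exact hunit (j + 1) g
    | succ b =>
      rw [expect_spineLaw_succ_succ]
      have h4 : ∀ L : Multiset (TruncTree b), expect (spineLaw m a j b (c + 1))
          (fun e : TruncTree b × Multiset (TruncTree c) => (e.2.map (g (e.1 ::ₘ L))).sum) = _ :=
        fun L => ih (by omega) (fun t => g (t ::ₘ L))
      simp only [h4, expect_add, expect_const_mul]
      rw [expect_spineLaw_succ_succ, pathLaw, expect_bind]
      simp only [expect_map]

end

section

variable {m : Kind → Kind → ℝ≥0} {a : ℝ≥0}

/-! ### Growth rate for the intersecting trees -/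

/-- Propagation of a bound `B` on the moments from independent Galton-Watson trees to independent
trees, the first of which contains a path. -/
theorem expect_pathLaw_weight_le {p : ℕ} (hp : 1 ≤ p) {t : ℝ≥0} (ht : 0 < t) (ht1 : t < 1)
    {B : ℕ → ℝ≥0∞} (hB : ∀ d, moment a p d ≤ B d)
    (hrec : ∀ d, ((1 - t : ℝ≥0) : ℝ≥0∞) * ((1 - t)⁻¹ : ℝ≥0) ^ p * moment a p (d + 1)
      + (t : ℝ≥0∞) * (t⁻¹ : ℝ≥0) ^ p * (a * B d) ≤ B (d + 1)) (j d : ℕ) :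
    expect (pathLaw a j d) (fun x => expect (gwLaw a d) (fun y => weight d x y ^ p)) ≤ B d := by
  induction j generalizing d with
  | zero => exact hB d
  | succ j ih =>
    cases d with
    | zero =>
      refine le_trans ?_ (hB 0)
      simp [weight, moment_zero_right]
    | succ d =>
      refine le_trans ?_ (hrec d)
      rw [pathLaw, expect_bind]
      simp only [expect_map]
      refine (expect_mono _ fun L => expect_mono _ fun x => expect_mono _ fun y =>
        weight_cons_pow_le ht ht1 hp x L y).trans ?_
      simp only [expect_add, expect_const_mul, expect_const]
      gcongr
      · exact le_rfl
      · have h : ∀ x : TruncTree d, expect (gwLaw a (d + 1)) (fun M : Multiset (TruncTree d) =>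
            (M.map fun y => weight d x y ^ p).sum) = _ := fun x => expect_gwLaw_succ_sum a d _
        simp only [h, expect_const_mul]
        gcongr
        exact ih d

/-- Propagation of a bound `B` on the moments from independent trees to intersecting trees. Along
the path to the second root, one pair of children is in the same situation as the pair of roots;
all the other pairs are independent. -/
theorem expect_spineLaw_weight_le (hm₁ : Balanced m a Kind.first)
    (hm₂ : Balanced m a Kind.second) {p : ℕ} (hp : 1 ≤ p) {t : ℝ≥0} (ht : 0 < t) (ht1 : t < 1)
    {B : ℕ → ℝ≥0∞} (hB : ∀ d, moment a p d ≤ B d)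
    (hrec : ∀ d, ((1 - t : ℝ≥0) : ℝ≥0∞) * ((1 - t)⁻¹ : ℝ≥0) ^ p * moment a p (d + 1)
      + (t : ℝ≥0∞) * (t⁻¹ : ℝ≥0) ^ p * (a * B d) ≤ B (d + 1)) (j d : ℕ) :
    expect (spineLaw m a (j + 1) d d) (fun e => weight d e.1 e.2 ^ p) ≤ B d := by
  induction d generalizing j with
  | zero =>
    refine le_trans ?_ (hB 0)
    simp [weight, moment_zero_right]
  | succ d ih =>
    refine le_trans ?_ (hrec d)
    rw [expect_spineLaw_succ_succ]
    have hk := expect_mono (gwLaw a (d + 1)) fun L : Multiset (TruncTree d) =>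
      expect_mono (spineLaw m a j d (d + 1)) fun e : TruncTree d × TruncTree (d + 1) =>
        weight_cons_pow_le ht ht1 hp e.1 L e.2
    refine hk.trans ?_
    simp only [expect_add, expect_const_mul, expect_const]
    gcongr
    · refine le_of_eq ?_
      rw [moment]
      congr 1
      funext L
      exact expect_spineLaw_snd hm₂ j d (d + 1) (fun y => weight (d + 1) L y ^ p)
    · have ha : (a : ℝ≥0∞) = m Kind.common Kind.common + m Kind.common Kind.second := by
        rw [← ENNReal.coe_add, hm₂.of_common]
      rw [expect_spineLaw_sum hm₁ hm₂ j le_rfl (fun x y => weight d x y ^ p), ha,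
        add_mul]
      gcongr
      · exact ih j
      · exact expect_pathLaw_weight_le hp ht ht1 hB hrec j d

/-- For slightly supercritical trees, all moments of the matching weight of intersecting trees grow
at a rate smaller than that of the trees, whatever the distance between the roots. -/
theorem exists_expect_spineLaw_le {lam : ℝ} (h1 : 1 < lam) (h2 : lam ≤ 1 + 1 / 200) :
    ∃ A : ℝ, 0 < A ∧ ∀ m : Kind → Kind → ℝ≥0, Balanced m lam.toNNReal Kind.first →
      Balanced m lam.toNNReal Kind.second → ∀ p d j : ℕ, 3 ≤ p →
      expect (spineLaw m lam.toNNReal (j + 1) d d) (fun e => weight d e.1 e.2 ^ p)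
        ≤ ENNReal.ofReal ((A * p * (1 + 3 / 4 * (lam - 1)) ^ d) ^ p) := by
  obtain ⟨A, hA, hmom⟩ := exists_moment_le h1 h2
  obtain ⟨ε, hε⟩ : ∃ ε, ε = lam - 1 := ⟨_, rfl⟩
  have hlam : lam = 1 + ε := by linarith
  have hε0 : 0 < ε := by linarith
  rw [← hε] at hmom ⊢
  set gam := 1 + 3 / 4 * ε with hgam
  have hg0 : 0 < gam := by positivity
  -- the weight in the convexity inequality, large enough for `lam ≤ (r * gam) ^ 3`
  set r : ℝ := (1 + 1 / 2 * ε) / gam with hr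
  have hr0 : 0 < r := by positivity
  have hr1 : r < 1 := (div_lt_one hg0).mpr (by rw [hgam]; linarith)
  have hrg : r * gam = 1 + 1 / 2 * ε := div_mul_cancel₀ _ hg0.ne'
  have hs0 : 0 < 1 - r := by linarith
  set t : ℝ≥0 := r.toNNReal with ht
  have htr : (t : ℝ) = r := Real.coe_toNNReal _ hr0.le
  have ht0 : 0 < t := Real.toNNReal_pos.mpr hr0
  have ht1 : t < 1 := by rw [← NNReal.coe_lt_coe, htr]; exact hr1
  refine ⟨A / (1 - r), by positivity, fun m hm₁ hm₂ p d j hp => ?_⟩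
  refine expect_spineLaw_weight_le hm₁ hm₂ (p := p) (by omega) ht0 ht1
    (B := fun d => ENNReal.ofReal ((A / (1 - r) * p * gam ^ d) ^ p)) (fun d => ?_) (fun d => ?_) j d
  · refine (hmom p d (by omega)).trans (ENNReal.ofReal_le_ofReal ?_)
    gcongr
    exact (le_div_iff₀ hs0).mpr (by nlinarith)
  · have e1 : ((1 - t : ℝ≥0) : ℝ≥0∞) = ENNReal.ofReal (1 - r) := by
      rw [← htr, ← ENNReal.ofReal_coe_nnreal, NNReal.coe_sub ht1.le, NNReal.coe_one]
    have e2 : (((1 - t)⁻¹ : ℝ≥0) : ℝ≥0∞) = ENNReal.ofReal ((1 - r)⁻¹) := by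
      rw [← htr, ← ENNReal.ofReal_coe_nnreal, NNReal.coe_inv, NNReal.coe_sub ht1.le, NNReal.coe_one]
    have e3 : (t : ℝ≥0∞) = ENNReal.ofReal r := by rw [← htr, ENNReal.ofReal_coe_nnreal]
    have e4 : ((t⁻¹ : ℝ≥0) : ℝ≥0∞) = ENNReal.ofReal (r⁻¹) := by
      rw [← htr, ← ENNReal.ofReal_coe_nnreal, NNReal.coe_inv]
    have e5 : ((lam.toNNReal : ℝ≥0) : ℝ≥0∞) = ENNReal.ofReal lam := rfl
    have hri : 0 ≤ r⁻¹ := by positivity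
    have hsi : 0 ≤ (1 - r)⁻¹ := by positivity
    have hl0 : 0 ≤ lam := by linarith
    rw [e1, e2, e3, e4, e5]
    refine (add_le_add_left (mul_le_mul_right (hmom p (d + 1) (by omega)) _) _).trans ?_
    rw [← ENNReal.ofReal_pow hsi, ← ENNReal.ofReal_pow hri, ← ENNReal.ofReal_mul hs0.le,
      ← ENNReal.ofReal_mul hr0.le, ← ENNReal.ofReal_mul (by positivity),
      ← ENNReal.ofReal_mul hl0, ← ENNReal.ofReal_mul (by positivity),
      ← ENNReal.ofReal_add (by positivity) (by positivity)]
    refine ENNReal.ofReal_le_ofReal ?_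
    have f1 : (1 - r) * (1 - r)⁻¹ ^ p * (A * p * gam ^ (d + 1)) ^ p
        = (1 - r) * (A / (1 - r) * p * gam ^ (d + 1)) ^ p := by
      rw [mul_assoc, ← mul_pow, div_eq_inv_mul]
      ring
    have f2 : r * r⁻¹ ^ p * (lam * (A / (1 - r) * p * gam ^ d) ^ p)
        = r * (lam / (r * gam) ^ p) * (A / (1 - r) * p * gam ^ (d + 1)) ^ p := by
      have e : A / (1 - r) * p * gam ^ (d + 1) = (A / (1 - r) * p * gam ^ d) * gam := by ring
      rw [e, mul_pow r gam, mul_pow (A / (1 - r) * p * gam ^ d) gam, inv_pow]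
      generalize (A / (1 - r) * p * gam ^ d) ^ p = z
      field_simp
    have f3 : lam / (r * gam) ^ p ≤ 1 := by
      rw [hrg, div_le_one (by positivity)]
      calc lam ≤ (1 + 1 / 2 * ε) ^ 3 := by
            have := one_add_mul_le_pow (a := 1 / 2 * ε) (by linarith) 3
            push_cast at this
            linarith
        _ ≤ (1 + 1 / 2 * ε) ^ p := pow_le_pow_right₀ (by linarith) hp
    rw [f1, f2]
    have f4 : r * (lam / (r * gam) ^ p) ≤ r * 1 := by gcongr
    have f5 : 0 ≤ (A / (1 - r) * p * gam ^ (d + 1)) ^ p := by positivity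
    have := mul_le_mul_of_nonneg_right f4 f5
    linarith

end

section

/-! ### Discrete variables that depend on a block of coordinates -/

/-- The σ-algebra generated by the coordinates in `S`. -/
abbrev coordSpace (S : Set (Label × Kind)) : MeasurableSpace Offspring :=
  ⨆ q ∈ S, MeasurableSpace.comap (fun ω : Offspring => ω q) inferInstance

theorem coordSpace_mono {S T : Set (Label × Kind)} (h : S ⊆ T) : coordSpace S ≤ coordSpace T :=
  biSup_mono h

theorem coordSpace_le (S : Set (Label × Kind)) : coordSpace S ≤ MeasurableSpace.pi :=
  iSup₂_le fun q _ => (measurable_pi_apply q).comap_le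

variable {lam s : ℝ} {δ : ℕ}

theorem indep_coordSpace {S T : Set (Label × Kind)} (h : Disjoint S T) :
    Indep (coordSpace S) (coordSpace T) (offspringLaw lam s δ) := by
  refine indep_iSup_of_disjoint (fun q => (measurable_pi_apply q).comap_le) ?_ h
  exact iIndepFun_infinitePi (X := fun _ (n : ℕ) => n) (fun _ => measurable_id)

instance : IsProbabilityMeasure (offspringLaw lam s δ) := by
  unfold offspringLaw
  infer_instance

/-- The variable `X` is a function of the coordinates in `S` and has law `p`. -/
structure BlockLaw (lam s : ℝ) (δ : ℕ) {α : Type} (S : Set (Label × Kind)) (X : Offspring → α)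
    (p : PMF α) : Prop where
  measurableSet_eq : ∀ x, MeasurableSet[coordSpace S] {ω | X ω = x}
  measure_eq : ∀ x, offspringLaw lam s δ {ω | X ω = x} = p x

namespace BlockLaw

variable {α β : Type} {S T : Set (Label × Kind)} {X : Offspring → α} {Y : Offspring → β}
  {p : PMF α} {q : PMF β}

theorem mono (h : BlockLaw lam s δ S X p) (hST : S ⊆ T) : BlockLaw lam s δ T X p :=
  ⟨fun x => coordSpace_mono hST _ (h.measurableSet_eq x), h.measure_eq⟩

theorem measurableSet_preimage [Countable α] (h : BlockLaw lam s δ S X p) (A : Set α) :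
    MeasurableSet[coordSpace S] (X ⁻¹' A) := by
  have : X ⁻¹' A = ⋃ x ∈ A, {ω | X ω = x} := by
    ext ω
    simp
  rw [this]
  exact MeasurableSet.biUnion (Set.to_countable A) fun x _ => h.measurableSet_eq x

theorem lintegral [Countable α] (h : BlockLaw lam s δ S X p) (f : α → ℝ≥0∞) :
    ∫⁻ ω, f (X ω) ∂offspringLaw lam s δ = expect p f := by
  let _ : MeasurableSpace α := ⊤
  have hX : Measurable X := fun A _ => coordSpace_le S _ (h.measurableSet_preimage A)
  rw [← lintegral_map (f := f) (fun _ _ => trivial) hX, lintegral_countable']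
  refine tsum_congr fun x => ?_
  rw [Measure.map_apply hX trivial, mul_comm, ← h.measure_eq]
  rfl

theorem measure_preimage [Countable α] (h : BlockLaw lam s δ S X p) (A : Set α) :
    offspringLaw lam s δ (X ⁻¹' A) = expect p (A.indicator 1) := by
  rw [← h.lintegral, ← lintegral_indicator_one (coordSpace_le S _ (h.measurableSet_preimage A))]
  rfl

theorem map [Countable α] (h : BlockLaw lam s δ S X p) (g : α → β) :
    BlockLaw lam s δ S (fun ω => g (X ω)) (p.map g) := by
  classical
  refine ⟨fun y => h.measurableSet_preimage (g ⁻¹' {y}), fun y => ?_⟩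
  have h1 := h.measure_preimage (g ⁻¹' {y})
  refine Eq.trans h1 ?_
  have h2 : p.map g y = expect (p.map g) (fun z => if z = y then 1 else 0) := by simp [expect]
  rw [h2, expect_map]
  rfl

theorem prod (hX : BlockLaw lam s δ S X p) (hY : BlockLaw lam s δ T Y q) (hST : Disjoint S T) :
    BlockLaw lam s δ (S ∪ T) (fun ω => (X ω, Y ω)) (p.bind fun x => q.map (Prod.mk x)) := by
  classical
  have hset : ∀ z : α × β, {ω | (X ω, Y ω) = z} = {ω | X ω = z.1} ∩ {ω | Y ω = z.2} := by
    intro z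
    ext ω
    simp [Prod.ext_iff]
  refine ⟨fun z => ?_, fun z => ?_⟩
  · rw [hset]
    exact (coordSpace_mono Set.subset_union_left _ (hX.measurableSet_eq _)).inter
      (coordSpace_mono Set.subset_union_right _ (hY.measurableSet_eq _))
  · rw [hset, (Indep_iff _ _ _).mp (indep_coordSpace hST) _ _ (hX.measurableSet_eq _)
      (hY.measurableSet_eq _), hX.measure_eq, hY.measure_eq]
    have h2 : ∀ r : PMF (α × β), r z = expect r (fun w => if w = z then 1 else 0) := by
      simp [expect]
    rw [h2, expect_bind]
    simp only [expect_map, Prod.ext_iff]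
    have h3 : ∀ x, expect q (fun y => if x = z.1 ∧ y = z.2 then 1 else 0)
        = (if x = z.1 then 1 else 0) * q z.2 := by
      intro x
      by_cases hx : x = z.1 <;> simp [expect, hx]
    simp only [h3, expect_mul_const]
    simp [expect]

/-- The list of the first `k` variables of an independent sequence. -/
theorem list_range [Countable α] {S : ℕ → Set (Label × Kind)} {X : ℕ → Offspring → α}
    (h : ∀ n, BlockLaw lam s δ (S n) (X n) p) (hS : Pairwise fun i j => Disjoint (S i) (S j))
    (k : ℕ) :
    BlockLaw lam s δ (⋃ n < k, S n) (fun ω => (List.range k).map fun n => X n ω)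
      (iidList p k) := by
  classical
  induction k with
  | zero =>
    refine ⟨fun x => ?_, fun x => ?_⟩
    · by_cases hx : [] = x <;> simp [hx]
    · cases x <;> simp [iidList]
  | succ k ih =>
    have hdisj : Disjoint (⋃ n < k, S n) (S k) := by
      simp only [Set.disjoint_iUnion_left]
      exact fun n hn => hS hn.ne
    have h1 := ((ih.prod (h k) hdisj).map (fun z => z.1 ++ [z.2])).mono
      (T := ⋃ n < k + 1, S n) (by
        refine Set.union_subset ?_ ?_
        · exact Set.biUnion_subset_biUnion_left fun n (hn : n < k) => Nat.lt_succ_of_lt hn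
        · exact Set.subset_biUnion_of_mem (u := fun n => S n)
            (show k ∈ {n | n < k + 1} from Nat.lt_succ_self k))
    have hlaw : ((iidList p k).bind fun x => p.map (Prod.mk x)).map (fun z => z.1 ++ [z.2])
        = iidList p (k + 1) := by
      refine expect_eq_of_forall fun f => ?_
      rw [← expect_iidList_append, expect_map, expect_bind]
      simp only [expect_map, expect_iidList_succ p 0, expect_iidList_zero]
    rw [hlaw] at h1
    simpa [List.range_succ] using h1

/-- A list of independent variables of random Poisson length. -/
theorem list_range_poisson [Countable α] {S : ℕ → Set (Label × Kind)} {S₀ : Set (Label × Kind)}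
    {X : ℕ → Offspring → α} {N : Offspring → ℕ} {a : ℝ≥0}
    (hN : BlockLaw lam s δ S₀ N (poisson a))
    (h : ∀ n, BlockLaw lam s δ (S n) (X n) p) (hS : Pairwise fun i j => Disjoint (S i) (S j))
    (hS₀ : ∀ n, Disjoint S₀ (S n)) :
    BlockLaw lam s δ (S₀ ∪ ⋃ n, S n) (fun ω => (List.range (N ω)).map fun n => X n ω)
      (poissonList a p) := by
  have hpair := fun k => hN.prod (list_range h hS k) (by
    simp only [Set.disjoint_iUnion_right]
    exact fun n _ => hS₀ n)
  have hset : ∀ l : List α, {ω | (List.range (N ω)).map (fun n => X n ω) = l}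
      = {ω | (N ω, (List.range l.length).map fun n => X n ω) = (l.length, l)} := by
    intro l
    ext ω
    simp only [Set.mem_ofPred_eq, Prod.mk.injEq]
    constructor
    · intro hl
      have : N ω = l.length := by rw [← hl]; simp
      exact ⟨this, by rw [← this]; exact hl⟩
    · rintro ⟨h1, h2⟩
      rw [h1, h2]
  refine ⟨fun l => ?_, fun l => ?_⟩
  · rw [hset]
    refine coordSpace_mono ?_ _ ((hpair l.length).measurableSet_eq _)
    exact Set.union_subset_union_right _ (Set.iUnion_mono fun n => Set.iUnion_subset fun _ => le_rfl)
  · rw [hset, (hpair l.length).measure_eq, poissonList_apply]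
    classical
    have h2 : ∀ r : PMF (ℕ × List α), r (l.length, l)
        = expect r (fun w => if w = (l.length, l) then 1 else 0) := by
      simp [expect]
    rw [h2, expect_bind]
    simp only [expect_map, Prod.mk.injEq]
    have h3 : ∀ k, expect (iidList p l.length) (fun y => if k = l.length ∧ y = l then 1 else 0)
        = (if k = l.length then 1 else 0) * iidList p l.length l := by
      intro x
      by_cases hx : x = l.length <;> simp [expect, hx]
    simp only [h3, expect_mul_const, iidList_apply]
    simp [expect]

end BlockLaw

/-! ### The law of the coloured tree above a vertex -/

instance : Finite Kind :=
  Finite.of_injective (β := Fin 3) (kindFun 0 1 2) (by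
    intro x y h
    cases x <;> cases y <;> simp [kindFun] at h ⊢)

instance countable_colTree : ∀ d, Countable (ColTree d)
  | 0 => inferInstanceAs (Countable Unit)
  | d + 1 => by
    have := countable_colTree d
    exact inferInstanceAs (Countable (Kind → List (ColTree d)))

instance countable_truncTree : ∀ d, Countable (TruncTree d)
  | 0 => inferInstanceAs (Countable Unit)
  | d + 1 => by
    have := countable_truncTree d
    exact inferInstanceAs (Countable (Quotient (List.isSetoid (TruncTree d))))

/-- The mean offspring numbers of the model. -/
def kindMean (lam s : ℝ) (κ κ' : Kind) : ℝ≥0 := (offspringMean lam s κ κ').toNNReal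

theorem balanced_first (hlam : 0 ≤ lam) (hs0 : 0 ≤ s) (hs1 : s ≤ 1) :
    Balanced (kindMean lam s) lam.toNNReal Kind.first := by
  constructor
  · simp only [kindMean, offspringMean]
    rw [← Real.toNNReal_add (by positivity) (mul_nonneg hlam (by linarith))]
    congr 1
    ring
  · simp [kindMean, offspringMean]

theorem balanced_second (hlam : 0 ≤ lam) (hs0 : 0 ≤ s) (hs1 : s ≤ 1) :
    Balanced (kindMean lam s) lam.toNNReal Kind.second := by
  constructor
  · simp only [kindMean, offspringMean]
    rw [← Real.toNNReal_add (by positivity) (mul_nonneg hlam (by linarith))]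
    congr 1
    ring
  · simp [kindMean, offspringMean]

/-- The label of a child. -/
def childLabel (l : Label) (κ : Kind) (n : ℕ) : Label := (l.1, (κ, n) :: l.2)

/-- The coloured tree above a label, truncated at depth `d`. -/
def colTree (ω : Offspring) : (d : ℕ) → Label → ColTree d
  | 0, _ => ()
  | d + 1, l => fun κ => (List.range (ω (l, κ))).map fun n => colTree ω d (childLabel l κ n)

/-- The coordinates of the labels above a given label. -/
def coordsAbove (l : Label) : Set (Label × Kind) := {q | q.1.1 = l.1 ∧ l.2 <:+ q.1.2}

theorem coordsAbove_childLabel_subset (l : Label) (κ : Kind) (n : ℕ) :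
    coordsAbove (childLabel l κ n) ⊆ coordsAbove l :=
  fun _ hq => ⟨hq.1, (List.suffix_cons _ _).trans hq.2⟩

theorem disjoint_coordsAbove_childLabel (l : Label) {κ κ' : Kind} {n n' : ℕ}
    (h : (κ, n) ≠ (κ', n')) :
    Disjoint (coordsAbove (childLabel l κ n)) (coordsAbove (childLabel l κ' n')) := by
  rw [Set.disjoint_left]
  rintro q ⟨_, h1⟩ ⟨_, h2⟩
  have h3 := (List.suffix_of_suffix_length_le h1 h2 (by simp [childLabel])).eq_of_length
    (by simp [childLabel])
  simp only [childLabel, List.cons.injEq] at h3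
  exact h h3.1

theorem notMem_coordsAbove_childLabel (l : Label) (κ κ' : Kind) (n : ℕ) :
    (l, κ') ∉ coordsAbove (childLabel l κ n) := by
  rintro ⟨_, h⟩
  have := h.length_le
  simp [childLabel] at this

/-- The coordinates on which the list of the children of kind `κ` and their subtrees depend. -/
def coordsOfKind (l : Label) (κ : Kind) : Set (Label × Kind) :=
  {(l, κ)} ∪ ⋃ n, coordsAbove (childLabel l κ n)

theorem coordsOfKind_subset (l : Label) (κ : Kind) : coordsOfKind l κ ⊆ coordsAbove l := by
  refine Set.union_subset ?_ (Set.iUnion_subset fun n => coordsAbove_childLabel_subset l κ n)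
  rintro _ rfl
  exact ⟨rfl, List.suffix_rfl⟩

theorem disjoint_coordsOfKind (l : Label) {κ κ' : Kind} (h : κ ≠ κ') :
    Disjoint (coordsOfKind l κ) (coordsOfKind l κ') := by
  simp only [coordsOfKind, Set.disjoint_union_left, Set.disjoint_union_right,
    Set.disjoint_iUnion_left, Set.disjoint_iUnion_right]
  refine ⟨⟨?_, fun n => ?_⟩, fun n => ⟨?_, fun n' => ?_⟩⟩
  · simpa using h
  · exact Set.disjoint_singleton_right.mpr (notMem_coordsAbove_childLabel _ _ _ _)
  · exact Set.disjoint_singleton_left.mpr (notMem_coordsAbove_childLabel _ _ _ _)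
  · exact disjoint_coordsAbove_childLabel l (by simp [h])

theorem blockLaw_coord (q : Label × Kind) :
    BlockLaw lam s δ {q} (fun ω => ω q)
      (poisson (kindMean lam s (kindOf δ q.1) q.2)) := by
  refine ⟨fun n => ?_, fun n => ?_⟩
  · refine MeasurableSpace.le_def.mp (le_iSup₂_of_le q (Set.mem_singleton q) le_rfl) _ ?_
    exact ⟨{n}, trivial, rfl⟩
  · rw [poisson, Measure.toPMF_apply]
    have h := Measure.infinitePi_map_eval (fun q : Label × Kind =>
      poissonMeasure (offspringMean lam s (kindOf δ q.1) q.2).toNNReal) q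
    rw [kindMean, ← h, Measure.map_apply (measurable_pi_apply q) (measurableSet_singleton n)]
    rfl

theorem blockLaw_colTree (d : ℕ) (l : Label) :
    BlockLaw lam s δ (coordsAbove l) (fun ω => colTree ω d l)
      (colLaw (kindMean lam s) d (kindOf δ l)) := by
  induction d generalizing l with
  | zero =>
    refine ⟨fun x => ?_, fun x => ?_⟩
    · simp [colTree]
    · simp [colTree, colLaw]
  | succ d ih =>
    have hkind : ∀ κ, BlockLaw lam s δ (coordsOfKind l κ)
        (fun ω => (List.range (ω (l, κ))).map fun n => colTree ω d (childLabel l κ n))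
        (poissonList (kindMean lam s (kindOf δ l) κ) (colLaw (kindMean lam s) d κ)) := by
      intro κ
      refine BlockLaw.list_range_poisson (blockLaw_coord (l, κ))
        (fun n => ih (childLabel l κ n)) ?_ ?_
      · intro i j hij
        exact disjoint_coordsAbove_childLabel l (by simp [hij])
      · intro n
        rw [Set.disjoint_singleton_left]
        exact notMem_coordsAbove_childLabel _ _ _ _
    have h1 := (((hkind Kind.common).prod ((hkind Kind.first).prod (hkind Kind.second)
      (disjoint_coordsOfKind l (by simp)))
      (Set.disjoint_union_right.mpr ⟨disjoint_coordsOfKind l (by simp),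
        disjoint_coordsOfKind l (by simp)⟩)).map
      (fun z => kindFun z.1 z.2.1 z.2.2)).mono (T := coordsAbove l)
      (Set.union_subset (coordsOfKind_subset _ _)
        (Set.union_subset (coordsOfKind_subset _ _) (coordsOfKind_subset _ _)))
    convert h1 using 1
    · funext ω κ
      cases κ <;> rfl
    · refine expect_eq_of_forall fun f => ?_
      rw [expect_colLaw_succ, expect_map]
      simp only [expect_bind, expect_map]

end

section

variable {lam s : ℝ} {δ : ℕ}

/-! ### Comparison of the matching weights -/

/-- The truncated tree above `l`, where `ch` gives the children of each label. -/
def truncTree {A : Type} (ch : A → Multiset A) : (b : ℕ) → A → TruncTree b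
  | 0, _ => ()
  | b + 1, l => Multiset.map (truncTree ch b) (ch l)

/-- The descendants of `v` at distance `d` from `v`. -/
def descendants (t : RootedTree.{0}) : ℕ → t → Set t
  | 0, v => {v}
  | d + 1, v => ⋃ c ∈ {c : t | c ≠ ⊥ ∧ Order.pred c = v}, descendants t d c

theorem mem_descendants {t : RootedTree.{0}} {d : ℕ} {v w : t} (h : Order.pred^[d] w = v)
    (hne : ∀ i < d, Order.pred^[i] w ≠ ⊥) : w ∈ descendants t d v := by
  induction d generalizing v with
  | zero => exact h
  | succ d ih =>
    rw [Function.iterate_succ_apply'] at h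
    exact Set.mem_biUnion (show Order.pred^[d] w ∈ {c : t | c ≠ ⊥ ∧ Order.pred c = v} from
      ⟨hne d (Nat.lt_succ_self d), h⟩) (ih rfl fun i hi => hne i (Nat.lt_succ_of_lt hi))

theorem level_subset_descendants (t : RootedTree.{0}) (d : ℕ) : level t d ⊆ descendants t d ⊥ := by
  intro w hw
  have hex : {n : ℕ | Order.pred^[n] w = ⊥}.Nonempty := exists_pred_iterate_of_le bot_le
  have hd : sInf {n : ℕ | Order.pred^[n] w = ⊥} = d := hw
  refine mem_descendants ?_ fun i hi => ?_
  · rw [← hd]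
    exact Nat.sInf_mem hex
  · rw [← hd] at hi
    exact Nat.notMem_of_lt_sInf hi

theorem encard_biUnion_finset_le {α β : Type} (S : Finset α) (D : α → Set β) :
    ((⋃ c ∈ S, D c).encard : ℝ≥0∞) ≤ ∑ c ∈ S, ((D c).encard : ℝ≥0∞) := by
  classical
  induction S using Finset.induction_on with
  | empty => simp
  | insert c S hc ih =>
    rw [Finset.set_biUnion_insert, Finset.sum_insert hc]
    refine le_trans (ENat.toENNReal_mono (Set.encard_union_le _ _)) ?_
    rw [ENat.toENNReal_add]
    gcongr

/-- The number of descendants at distance `d` in a tree that embeds in two trees is at most the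
weight of the truncations of these trees. -/
theorem encard_descendants_le {A A' : Type} {ch : A → Multiset A} {ch' : A' → Multiset A'}
    {t : RootedTree.{0}} {F : t → A} {F' : t → A'} (hF : Function.Injective F)
    (hF' : Function.Injective F') (hch : ∀ c : t, c ≠ ⊥ → F c ∈ ch (F (Order.pred c)))
    (hch' : ∀ c : t, c ≠ ⊥ → F' c ∈ ch' (F' (Order.pred c))) (d : ℕ) (v : t) :
    ((descendants t d v).encard : ℝ≥0∞)
      ≤ weight d (truncTree ch d (F v)) (truncTree ch' d (F' v)) := by
  classical
  induction d generalizing v with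
  | zero => simp [descendants, weight]
  | succ d ih =>
    have hfin : {c : t | c ≠ ⊥ ∧ Order.pred c = v}.Finite := by
      refine Set.Finite.of_injOn (f := F) (t := {l | l ∈ ch (F v)}) ?_ hF.injOn
        (Multiset.finite_toSet _)
      rintro c ⟨hc, rfl⟩
      exact hch c hc
    set S := hfin.toFinset with hS
    have hmem : ∀ c ∈ S, c ≠ ⊥ ∧ Order.pred c = v := fun c hc => by simpa [hS] using hc
    have hunion : descendants t (d + 1) v = ⋃ c ∈ S, descendants t d c := by
      simp [descendants, hS]
    rw [hunion]
    refine (encard_biUnion_finset_le S _).trans ((Finset.sum_le_sum fun c _ => ih c).trans ?_)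
    have hmatch : IsMatching (truncTree ch (d + 1) (F v)) (truncTree ch' (d + 1) (F' v))
        (S.val.map fun c => (truncTree ch d (F c), truncTree ch' d (F' c))) := by
      constructor
      · rw [Multiset.map_map, truncTree]
        have : S.val.map F ≤ ch (F v) := by
          rw [Multiset.le_iff_subset (S.nodup.map hF)]
          intro l hl
          obtain ⟨c, hc, rfl⟩ := Multiset.mem_map.mp hl
          obtain ⟨h1, rfl⟩ := hmem c hc
          exact hch c h1
        have h2 := Multiset.map_le_map (f := truncTree ch d) this
        rwa [Multiset.map_map] at h2
      · rw [Multiset.map_map, truncTree]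
        have : S.val.map F' ≤ ch' (F' v) := by
          rw [Multiset.le_iff_subset (S.nodup.map hF')]
          intro l hl
          obtain ⟨c, hc, rfl⟩ := Multiset.mem_map.mp hl
          obtain ⟨h1, rfl⟩ := hmem c hc
          exact hch' c h1
        have h2 := Multiset.map_le_map (f := truncTree ch' d) this
        rwa [Multiset.map_map] at h2
    refine le_trans (le_of_eq ?_) (sum_le_weight hmatch)
    rw [Multiset.map_map]
    rfl

/-- The children of a label in the first tree. -/
def childrenFirst (δ : ℕ) (ω : Offspring) (l : Label) : Multiset Label :=
  (if l.2 = [] ∧ l.1 < δ then {(l.1 + 1, [])} else 0)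
    + (((Multiset.range (ω (l, Kind.common))).map fun n => childLabel l Kind.common n)
      + (Multiset.range (ω (l, Kind.first))).map fun n => childLabel l Kind.first n)

/-- The children of a label in the second tree. -/
def childrenSecond (ω : Offspring) (l : Label) : Multiset Label :=
  ((Multiset.range (ω (l, Kind.common))).map fun n => childLabel l Kind.common n)
    + (Multiset.range (ω (l, Kind.second))).map fun n => childLabel l Kind.second n

theorem mem_childrenFirst {ω : Offspring} : ∀ {l : Label}, InFirst δ ω l → l ≠ (0, []) →
    l ∈ childrenFirst δ ω (parentLabel l)
  | (0, []), _, h0 => absurd rfl h0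
  | (k + 1, []), h, _ => by
    rw [InFirst] at h
    simp [childrenFirst, parentLabel, Nat.lt_of_succ_le h]
  | (k, (κ, n) :: w), h, _ => by
    rw [parentLabel_cons]
    rw [InFirst] at h
    obtain ⟨h1, h2, -⟩ := h
    cases κ
    · simp [childrenFirst, childLabel, h2]
    · simp [childrenFirst, childLabel, h2]
    · exact absurd rfl h1

theorem mem_childrenSecond {ω : Offspring} {w : List (Kind × ℕ)} (h : InSecond δ ω w)
    (h0 : w ≠ []) : (δ, w) ∈ childrenSecond ω (δ, w.tail) := by
  obtain - | ⟨⟨κ, n⟩, w⟩ := w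
  · exact absurd rfl h0
  obtain ⟨h1, h2, -⟩ := h
  cases κ
  · simp [childrenSecond, childLabel, h2]
  · exact absurd rfl h1
  · simp [childrenSecond, childLabel, h2]

/-- The matching weight is at most the weight of the truncated trees. -/
theorem matchingWeight_le (δ : ℕ) (ω : Offspring) (d : ℕ) :
    ((matchingWeight d (firstTree δ ω) (secondTree δ ω) : ℕ∞) : ℝ≥0∞)
      ≤ weight d (truncTree (childrenFirst δ ω) d (0, []))
          (truncTree (childrenSecond ω) d (δ, [])) := by
  rw [matchingWeight, ENat.toENNReal_iSup]
  refine iSup_le fun t => ?_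
  rw [ENat.toENNReal_iSup]
  refine iSup_le fun ht => ?_
  obtain ⟨-, ⟨f, hf⟩, ⟨f', hf'⟩⟩ := ht
  let F : t → Label := fun v => Subtype.val (p := InFirst δ ω) (f v)
  let F' : t → Label := fun v => (δ, Subtype.val (p := InSecond δ ω) (f' v))
  have hF : Function.Injective F := fun v w h => hf.injective (Subtype.val_injective h)
  have hF' : Function.Injective F' := fun v w h =>
    hf'.injective (Subtype.val_injective (Prod.ext_iff.mp h).2)
  have hroot : F ⊥ = (0, []) := congrArg (Subtype.val (p := InFirst δ ω)) hf.map_root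
  have hroot' : F' ⊥ = (δ, []) :=
    congrArg (fun w => (δ, Subtype.val (p := InSecond δ ω) w)) hf'.map_root
  rw [← hroot, ← hroot']
  refine le_trans (ENat.toENNReal_mono (Set.encard_le_encard (level_subset_descendants t d)))
    (encard_descendants_le hF hF' (fun c hc => ?_) (fun c hc => ?_) d ⊥)
  · have hpar : F (Order.pred c) = parentLabel (F c) :=
      congrArg (Subtype.val (p := InFirst δ ω)) (hf.map_parent c hc)
    rw [hpar]
    exact mem_childrenFirst (Subtype.prop (p := InFirst δ ω) (f c))
      fun h => hc (hF (h.trans hroot.symm))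
  · have hpar : F' (Order.pred c) = (δ, (F' c).2.tail) :=
      congrArg (fun w => (δ, Subtype.val (p := InSecond δ ω) w)) (hf'.map_parent c hc)
    rw [hpar]
    refine mem_childrenSecond (Subtype.prop (p := InSecond δ ω) (f' c)) fun h => ?_
    exact hc (hF' ((Prod.ext rfl h : F' c = (δ, [])).trans hroot'.symm))

/-! ### The joint law of the truncated trees -/

theorem truncTree_childrenSecond (ω : Offspring) {b D : ℕ} (hb : b ≤ D) (l : Label) :
    truncTree (childrenSecond ω) b l = proj Kind.second b D (colTree ω D l) := by
  induction D generalizing b l with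
  | zero =>
    obtain rfl : b = 0 := by omega
    rfl
  | succ D ih =>
    cases b with
    | zero => rfl
    | succ b =>
      simp only [truncTree, childrenSecond, proj, colTree, Multiset.map_add, Multiset.map_map,
        ← Multiset.map_coe, Multiset.coe_range]
      congr 1 <;> exact Multiset.map_congr rfl fun n _ => ih (by omega) _

theorem truncTree_childrenFirst (ω : Offspring) {b D : ℕ} (hb : b ≤ D) (l : Label)
    (hl : ¬ (l.2 = [] ∧ l.1 < δ)) :
    truncTree (childrenFirst δ ω) b l = proj Kind.first b D (colTree ω D l) := by
  induction D generalizing b l with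
  | zero =>
    obtain rfl : b = 0 := by omega
    rfl
  | succ D ih =>
    cases b with
    | zero => rfl
    | succ b =>
      simp only [truncTree, childrenFirst, if_neg hl, zero_add, proj, colTree, Multiset.map_add,
        Multiset.map_map, ← Multiset.map_coe, Multiset.coe_range]
      congr 1 <;> exact Multiset.map_congr rfl fun n _ => ih (by omega) _ (by simp [childLabel])

/-- Above a vertex of the path before `ρ'`, one child leads to `ρ'` and the other children are
encoded by the coloured tree. -/
theorem truncTree_childrenFirst_path (ω : Offspring) (b : ℕ) {k : ℕ} (hk : k < δ) :
    truncTree (childrenFirst δ ω) (b + 1) (k, [])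
      = (truncTree (childrenFirst δ ω) b (k + 1, []) ::ₘ
          proj Kind.first (b + 1) (b + 1) (colTree ω (b + 1) (k, [])) : Multiset (TruncTree b)) := by
  have h : childrenFirst δ ω (k, []) = (k + 1, []) ::ₘ
      (((Multiset.range (ω ((k, []), Kind.common))).map fun n => childLabel (k, []) Kind.common n)
      + (Multiset.range (ω ((k, []), Kind.first))).map fun n => childLabel (k, []) Kind.first n) := by
    simp [childrenFirst, hk]
  rw [truncTree, h]
  simp only [proj, colTree, Multiset.map_add, Multiset.map_cons, Multiset.map_map,
    ← Multiset.map_coe, Multiset.coe_range]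
  congr 2 <;> exact Multiset.map_congr rfl fun n _ =>
    truncTree_childrenFirst ω le_rfl _ (by simp [childLabel])

/-- The truncated first tree above the path vertex `(k, [])` and the truncated second tree have the
joint law `spineLaw`. -/
theorem blockLaw_truncTree (hm₁ : Balanced (kindMean lam s) lam.toNNReal Kind.first)
    (hm₂ : Balanced (kindMean lam s) lam.toNNReal Kind.second) {j k b c : ℕ} (hjk : k + j = δ)
    (hb : b ≤ c) :
    BlockLaw lam s δ {q | k ≤ q.1.1}
      (fun ω => (truncTree (childrenFirst δ ω) b (k, []), truncTree (childrenSecond ω) c (δ, [])))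
      (spineLaw (kindMean lam s) lam.toNNReal j b c) := by
  have hroot : BlockLaw lam s δ (coordsAbove (δ, [])) (fun ω => colTree ω c (δ, []))
      (colLaw (kindMean lam s) c Kind.common) := by
    have h := blockLaw_colTree (lam := lam) (s := s) (δ := δ) c (δ, [])
    simpa [kindOf] using h
  induction j generalizing k b with
  | zero =>
    obtain rfl : k = δ := by omega
    have h := (hroot.map fun t => (proj Kind.first b c t, proj Kind.second c c t)).mono
      (T := {q : Label × Kind | k ≤ q.1.1}) (fun q hq => hq.1.ge)
    rw [spineLaw]
    convert h using 4 with ω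
    · exact truncTree_childrenFirst ω hb _ (by simp)
    · exact truncTree_childrenSecond ω le_rfl _
  | succ j ih =>
    cases b with
    | zero =>
      have h := ((hroot.map fun t => proj Kind.second c c t).map fun t => (((), t) :
        TruncTree 0 × TruncTree c)).mono (T := {q : Label × Kind | k ≤ q.1.1})
        (fun q hq => by
          have : q.1.1 = δ := hq.1
          show k ≤ q.1.1
          omega)
      rw [colLaw_map_proj (by simp) hm₂ le_rfl (Or.inl rfl)] at h
      rw [spineLaw]
      convert h using 4 with ω
      exact truncTree_childrenSecond ω le_rfl _
    | succ b =>
      have hk : k < δ := by omega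
      have hside : BlockLaw lam s δ (coordsAbove (k, []))
          (fun ω => proj Kind.first (b + 1) (b + 1) (colTree ω (b + 1) (k, [])))
          (gwLaw lam.toNNReal (b + 1)) := by
        have h := blockLaw_colTree (lam := lam) (s := s) (δ := δ) (b + 1) (k, [])
        have hkind : kindOf δ (k, []) = Kind.first := by simp [kindOf, hk]
        rw [hkind] at h
        have h' := h.map (proj Kind.first (b + 1) (b + 1))
        rwa [colLaw_map_proj (by simp) hm₁ le_rfl (Or.inr rfl)] at h'
      have hrest := ih (k := k + 1) (b := b) (by omega) (by omega)
      have h := ((hside.prod hrest (by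
        rw [Set.disjoint_left]
        rintro q ⟨hq, -⟩ hq'
        have : k + 1 ≤ q.1.1 := hq'
        simp only at hq
        omega)).map (fun z => ((z.2.1 ::ₘ z.1 : Multiset (TruncTree b)), z.2.2))).mono
        (T := {q : Label × Kind | k ≤ q.1.1}) (by
          refine Set.union_subset (fun q hq => hq.1.ge) (fun q hq => ?_)
          have : k + 1 ≤ q.1.1 := hq
          show k ≤ q.1.1
          omega)
      convert h using 1
      · funext ω
        rw [truncTree_childrenFirst_path ω b hk]
      · refine expect_eq_of_forall fun f => ?_
        rw [expect_spineLaw_succ_succ, expect_map, expect_bind]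
        simp only [expect_map]

end

section

variable {lam s : ℝ} {δ : ℕ}

/-! ### Tail bounds -/

/-- The Markov bound obtained from the moment of order `⌊x⌋` when the moments of order `p` grow
like `p ^ p` is exponential in `x`. -/
theorem floor_div_pow_floor_le_exp {x : ℝ} (hx : 3 ≤ x) :
    ((⌊x⌋₊ : ℝ) / (Real.exp 1 * x)) ^ ⌊x⌋₊ ≤ Real.exp (-(x - 3)) := by
  have h1 : (⌊x⌋₊ : ℝ) ≤ x := Nat.floor_le (by linarith)
  have h2 := Nat.lt_floor_add_one x
  calc ((⌊x⌋₊ : ℝ) / (Real.exp 1 * x)) ^ ⌊x⌋₊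
      ≤ (x / (Real.exp 1 * x)) ^ ⌊x⌋₊ := by gcongr
    _ = Real.exp (-(⌊x⌋₊ : ℝ)) := by
        have : x / (Real.exp 1 * x) = Real.exp (-1) := by
          rw [Real.exp_neg]
          field_simp
        rw [this, ← Real.exp_nat_mul]
        ring_nf
    _ ≤ _ := Real.exp_le_exp.mpr (by linarith)

theorem gwMatchingRate_le (h1 : 1 < lam) (h2 : lam ≤ 1 + 1 / 200) (hs0 : 0 ≤ s) (hs1 : s ≤ 1)
    (hδ : 1 ≤ δ) : gwMatchingRate lam s δ ≤ ((1 + 3 / 4 * (lam - 1) : ℝ) : EReal) := by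
  obtain ⟨A, hA, hmom⟩ := exists_expect_spineLaw_le h1 h2
  have hm₁ := balanced_first (lam := lam) (s := s) (by linarith) hs0 hs1
  have hm₂ := balanced_second (lam := lam) (s := s) (by linarith) hs0 hs1
  set gam := 1 + 3 / 4 * (lam - 1) with hgam
  have hg0 : 0 < gam := by linarith
  obtain ⟨j, rfl⟩ : ∃ j, δ = j + 1 := ⟨δ - 1, by omega⟩
  refine sInf_le ⟨gam, ⟨Real.exp 1 * A, 3, 1, by positivity, by norm_num, by norm_num,
    fun x hx d _ => ?_⟩, rfl⟩
  rcases le_total x 3 with hx3 | hx3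
  · rw [max_eq_right (by linarith), neg_zero, Real.exp_zero, ENNReal.ofReal_one]
    exact prob_le_one
  rw [max_eq_left (by linarith)]
  have hx0 : 0 < x := by linarith
  set y := Real.exp 1 * A * x * gam ^ d with hy
  have hy0 : 0 < y := by positivity
  set p := ⌊x⌋₊ with hp
  have hp3 : 3 ≤ p := Nat.le_floor (by exact_mod_cast hx3)
  have hlaw := blockLaw_truncTree (lam := lam) (s := s) (δ := j + 1) hm₁ hm₂ (j := j + 1) (k := 0)
    (b := d) (c := d) (by omega) le_rfl
  set B : Set (TruncTree d × TruncTree d) := {e | ENNReal.ofReal y ≤ weight d e.1 e.2} with hB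
  have hsub : {ω | ((y : ℝ) : EReal) ≤
      (((matchingWeight d (firstTree (j + 1) ω) (secondTree (j + 1) ω) : ℕ∞) : ℝ≥0∞) : EReal)}
      ⊆ (fun ω => (truncTree (childrenFirst (j + 1) ω) d (0, []),
        truncTree (childrenSecond ω) d (j + 1, []))) ⁻¹' B := by
    intro ω hω
    have h3 : ((ENNReal.ofReal y : ℝ≥0∞) : EReal) ≤
        (((matchingWeight d (firstTree (j + 1) ω) (secondTree (j + 1) ω) : ℕ∞) : ℝ≥0∞) : EReal) := by
      rw [EReal.coe_ennreal_ofReal, max_eq_left hy0.le]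
      exact hω
    exact (EReal.coe_ennreal_le_coe_ennreal_iff.mp h3).trans (matchingWeight_le (j + 1) ω d)
  refine (measure_mono hsub).trans ?_
  rw [hlaw.measure_preimage]
  have hind : ∀ e : TruncTree d × TruncTree d, B.indicator (1 : TruncTree d × TruncTree d → ℝ≥0∞) e
      ≤ ENNReal.ofReal ((y ^ p)⁻¹) * weight d e.1 e.2 ^ p := by
    intro e
    by_cases he : e ∈ B
    · rw [Set.indicator_of_mem he, Pi.one_apply]
      calc (1 : ℝ≥0∞) = ENNReal.ofReal ((y ^ p)⁻¹) * ENNReal.ofReal y ^ p := by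
            rw [← ENNReal.ofReal_pow hy0.le, ← ENNReal.ofReal_mul (by positivity),
              inv_mul_cancel₀ (by positivity), ENNReal.ofReal_one]
        _ ≤ _ := by
            gcongr
            exact he
    · rw [Set.indicator_of_notMem he]
      exact zero_le
  refine (expect_mono _ hind).trans ?_
  rw [expect_const_mul]
  refine (mul_le_mul_right (hmom _ hm₁ hm₂ p d j hp3) _).trans ?_
  rw [← ENNReal.ofReal_mul (by positivity)]
  refine ENNReal.ofReal_le_ofReal (le_trans (le_of_eq ?_) (floor_div_pow_floor_le_exp hx3))
  rw [← inv_pow, ← mul_pow, ← hp]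
  congr 1
  rw [hy]
  field_simp

end

end TreeMatching

end

theorem mainTheorem3 :
    ∃ lam₀ : ℝ, 1 < lam₀ ∧ ∀ lam : ℝ, 1 < lam → lam ≤ lam₀ →
      ∀ s : ℝ, 0 ≤ s → s ≤ 1 →
        (⨆ (δ : ℕ) (_ : 1 ≤ δ), TreeMatching.gwMatchingRate lam s δ) < (lam : EReal) := by
  refine ⟨1 + 1 / 200, by norm_num, fun lam h1 h2 s hs0 hs1 => ?_⟩
  refine lt_of_le_of_lt (iSup₂_le fun δ hδ => TreeMatching.gwMatchingRate_le h1 h2 hs0 hs1 hδ) ?_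
  rw [EReal.coe_lt_coe_iff]
  linarith
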